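/- Let $N,K,K'\ge 1$ be integers with $K\le K'$, and let $M\in[0,N]$ and $r\ge 1$ be real numbers. A server holds $N$ files $W_1,\dots,W_N$, each consisting of $F$ symbols of a finite field of characteristic $2$ (so that addition is bitwise XOR $\oplus$). **Placement.** Each file $W_n$ is encoded by a $(\lfloor rF\rfloor,F)$ MDS code into $W'_n$ with $\lfloor rF\rfloor$ symbols (any $F$ of which determine $W_n$). Each of $K'$ users, independently for all users and files, caches a uniformly random set of exactly $\lfloor MF/N\rfloor$ symbols of each $W'_n$; so it caches at most $MF$ symbols. **Delivery.** Any $K$ of the users, numbered $1,\dots,K$, request files $\mathbf d=(d_1,\dots,d_K)\in[N]^K$. For $B\subseteq[K]$ let $W'_{n,B}$ be the sequence (in increasing order of position) of those symbols of $W'_n$ that are cached by exactly the users of $B$ among the $K$ requesting ones. Let $\mathcal U\subseteq[K]$ be a set of leaders, i.e. the $d_k$, $k\in\mathcal U$, are distinct and exhaust the requested files. For $j=K,K-1,\dots,1$ the server sends, for each $S\subseteq[K]$ with $|S|=j$ and $S\cap\mathcal U\neq\emptyset$, the first $\ell_j$ symbols of $\bigoplus_{k\in S}W'_{d_k,S\setminus\{k\}}$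 (segments padded with zeros), where $\ell_j$ is the smallest number such that either the messages of round $j$ are covered entirely ($\ell_j\ge|W'_{d_k,S\setminus\{k\}}|$ for all $|S|=j$, $k\in S$), or every user $k$ has at least $F$ symbols of $W'_{d_k}$, counting its cached symbols of $W'_{d_k}$ and $\sum_{S\ni k,|S|=i}\min\{\ell_i,|W'_{d_k,S\setminus\{k\}}|\}$ for each round $i\ge j$. (Thus $\ell_j=0$ once every user has $F$ symbols; if all the segments in round $j$ have the same size $g$ and all users had $a$ symbols before, then $\ell_j=\lceil\min\{g\binom{K-1}{j-1},F-a\}/\binom{K-1}{j-1}\rceil$, where $F-a$ is read as $0$ if $a>F$.) The normalized rate $R(\mathbf d)$ is the number of symbols sent, divided by $F$, and the worst-case normalized rate is $\max_{\mathbf d}R(\mathbf d)$. Let $q=\frac{M}{rN}$, $J=\min\{N,K\}$ and, for $x\ge1$, $$A(x)=\frac MN+\sum_{j=x}^{K}r q^{j-1}(1-q)^{K-j+1}\binom{K-1}{j-1}.$$ **Theorem.** 1. If $M<N$, there is exactly one $s\in\{1,\dots,K\}$ with $A(s+1)<1\le A(s)$. 2. For every $F$ there is a linear $(\lfloor rF\rfloor,F)$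 MDS code over some finite field of characteristic $2$. With any (not necessarily linear) such code, for every realization of the caches, every choice of the $K$ requesting users, all requests $\mathbf d$ and every choice of leaders, each requesting user $k$ recovers $W_{d_k}$ from its cache and the transmitted symbols. 3. If $s\in\{1,\dots,K\}$ satisfies $A(s+1)<1\le A(s)$, then, as $F\to\infty$, the worst-case normalized rate converges in probability (over the random placement; uniformly over the choice of the $K$ requesting users and of the leaders) to $$R_{\mathrm{dec}}=\sum_{j=s+1}^{K}r q^{j-1}(1-q)^{K-j+1}\left(\binom Kj-\binom{K-J}{j}\right)+\frac{1-A(s+1)}{\binom{K-1}{s-1}}\left(\binom Ks-\binom{K-J}{s}\right).$$ -/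

import Mathlib

open Finset

namespace CodedCaching

/-! ### MDS codes -/

/-- `enc` encodes `m` symbols into `n` symbols in such a way that any `m` of the `n` coded symbols
determine the message: an `(n, m)` MDS code. -/
def IsMDS {𝔽 : Type} {m n : ℕ} (enc : (Fin m → 𝔽) → (Fin n → 𝔽)) : Prop :=
  m ≤ n ∧ ∀ T : Finset (Fin n), T.card = m →
    ∀ w w' : Fin m → 𝔽, (∀ t ∈ T, enc w t = enc w' t) → w = w'

/-! ### Placement phase -/

/-- A placement for `K'` users and `N` coded files of `n` symbols each: every user picks, for every
coded file, a set of exactly `c` positions to cache. -/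
def Placement (K' N n c : ℕ) : Type :=
  Fin K' → Fin N → {T : Finset (Fin n) // T.card = c}

instance (K' N n c : ℕ) : Fintype (Placement K' N n c) :=
  inferInstanceAs (Fintype (Fin K' → Fin N → {T : Finset (Fin n) // T.card = c}))

instance (K' N n c : ℕ) : MeasurableSpace (Placement K' N n c) := ⊤

/-- The law of the random placement. Uniform on the finite product: all users and files choose
independently, each one uniformly among the sets of `c` positions. -/
noncomputable def placementLaw (K' N n c : ℕ) : MeasureTheory.Measure (Placement K' N n c) :=
  ProbabilityTheory.uniformOn Set.univ

/-- Positions cached by the `K` users that make a request: `Z k i` are the positions of coded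
file `i` that requesting user `k` has cached. -/
abbrev Caches (K N n : ℕ) : Type := Fin K → Fin N → Finset (Fin n)

/-- The caches of the requesting users `e 0, …, e (K-1)` among the `K'` users. -/
def Placement.caches {K K' N n c : ℕ} (ω : Placement K' N n c) (e : Fin K ↪ Fin K') :
    Caches K N n :=
  fun k i => (ω (e k) i).1

/-- Number of symbols of each coded file, `r F`. -/
noncomputable def codeLength (r : ℝ) (F : ℕ) : ℕ := ⌊r * F⌋₊

/-- Number of symbols of each coded file that a user caches, `M F / N`. -/
noncomputable def cacheShare (M : ℝ) (N F : ℕ) : ℕ := ⌊M * F / N⌋₊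

/-! ### Delivery phase -/

section Delivery

variable {K N n : ℕ}

/-- Positions of the segment `W'_{i,A}`: the symbols of coded file `i` that are cached by exactly
the requesting users in `A`. -/
def segment (Z : Caches K N n) (i : Fin N) (A : Finset (Fin K)) : Finset (Fin n) :=
  univ.filter fun t => ∀ k, t ∈ Z k i ↔ k ∈ A

/-- The `p`-th symbol of the segment of the coded file `w` at the positions `T` (in increasing
order), with zero padding beyond the end. -/
def paddedSymbol {𝔽 : Type} [Zero 𝔽] (w : Fin n → 𝔽) (T : Finset (Fin n)) (p : ℕ) : 𝔽 :=
  if h : p < T.card then w (T.orderEmbOfFin rfl ⟨p, h⟩) else 0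

/-- `U` is a set of leaders for the requests `d`: its members request different files, and every
requested file is requested by one of them. -/
def IsLeaderSet (d : Fin K → Fin N) (U : Finset (Fin K)) : Prop :=
  Set.InjOn d (U : Set (Fin K)) ∧ U.image d = univ.image d

/-- Length of the longest segment `W'_{d_k, S \ {k}}` with `k ∈ S`, `|S| = j`, that is, the common
length of the zero-padded messages of iteration `j`. -/
def seg (Z : Caches K N n) (d : Fin K → Fin N) (j : ℕ) : ℕ :=
  (powersetCard j univ).sup fun S => S.sup fun k => (segment Z (d k) (S.erase k)).card

/-- Number of symbols of its requested file that user `k` gets in iteration `j` when the first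
`l` symbols of each of the messages of that iteration are delivered. -/
def gain (Z : Caches K N n) (d : Fin K → Fin N) (j l : ℕ) (k : Fin K) : ℕ :=
  ∑ S ∈ (powersetCard j univ).filter (fun S => k ∈ S),
    min l (segment Z (d k) (S.erase k)).card

/-- Number of symbols sent of each message in iteration `j`, if user `k` already has `acc k`
symbols of its requested file: the whole messages, or, if that is shorter, just so many symbols
that every user attains `F` symbols. If all users have `F` symbols, this is `0`: the
iteration has ended. -/
noncomputable def roundLength (Z : Caches K N n) (d : Fin K → Fin N) (F j : ℕ)
    (acc : Fin K → ℕ) : ℕ :=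
  sInf {l | seg Z d j ≤ l ∨ ∀ k, F ≤ acc k + gain Z d j l k}

/-- If all segments that occur in iteration `j` have the same size `g` and all users have the same
number `a` of symbols, then `roundLength` is `min {g * C, F - a} / C` with `C = (K-1 choose j-1)`,
rounded up. -/
theorem roundLength_of_equal (Z : Caches K N n) (d : Fin K → Fin N) (F j g a : ℕ)
    (hj : 1 ≤ j) (hjK : j ≤ K)
    (hg : ∀ S : Finset (Fin K), S.card = j → ∀ k ∈ S, (segment Z (d k) (S.erase k)).card = g) :
    roundLength Z d F j (fun _ => a) =
      min (g * (K - 1).choose (j - 1)) (F - a) ⌈/⌉ (K - 1).choose (j - 1) := by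
  have hC : 0 < (K - 1).choose (j - 1) := Nat.choose_pos (by omega)
  have hgain : ∀ l k, gain Z d j l k = (K - 1).choose (j - 1) * min l g := by
    intro l k
    have hcard : ((powersetCard j (univ : Finset (Fin K))).filter (fun S => k ∈ S)).card =
        (K - 1).choose (j - 1) := by
      have : (powersetCard j (univ : Finset (Fin K))).filter (fun S => k ∈ S) =
          (powersetCard (j - 1) (univ.erase k)).image (insert k) := by
        ext S
        simp only [mem_filter, mem_powersetCard, subset_univ, true_and, mem_image]
        constructor
        · rintro ⟨h1, h2⟩
          exact ⟨S.erase k, ⟨erase_subset_erase k (subset_univ S), by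
            rw [card_erase_of_mem h2, h1]⟩, insert_erase h2⟩
        · rintro ⟨T, ⟨h1, h2⟩, rfl⟩
          have hk : k ∉ T := fun h => by simpa using h1 h
          exact ⟨by rw [card_insert_of_notMem hk, h2]; omega, mem_insert_self k T⟩
      rw [this, card_image_of_injOn, card_powersetCard]
      · simp
      · intro S hS T hT h
        have hS : k ∉ S := fun h => by simpa using (mem_powersetCard.1 hS).1 h
        have hT : k ∉ T := fun h => by simpa using (mem_powersetCard.1 hT).1 h
        rw [← erase_insert hS, ← erase_insert hT]
        exact congrArg (fun X => X.erase k) h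
    rw [gain, ← hcard, ← smul_eq_mul, ← sum_const]
    refine sum_congr rfl fun S hS => ?_
    rw [mem_filter, mem_powersetCard] at hS
    rw [hg S hS.1.2 k hS.2]
  have hseg : seg Z d j = g := by
    refine le_antisymm (Finset.sup_le fun S hS => Finset.sup_le fun k hk => ?_) ?_
    · exact (hg S (mem_powersetCard.1 hS).2 k hk).le
    · obtain ⟨S, -, hS⟩ := exists_subset_card_eq (s := (univ : Finset (Fin K))) (n := j)
        (by simpa using hjK)
      obtain ⟨k, hk⟩ := card_pos.1 (by omega : 0 < S.card)
      rw [← hg S hS k hk]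
      exact (le_sup (f := fun k => (segment Z (d k) (S.erase k)).card) hk).trans
        (le_sup (f := fun S => S.sup fun k => (segment Z (d k) (S.erase k)).card)
          (mem_powersetCard.2 ⟨subset_univ S, hS⟩))
  have k0 : Fin K := ⟨0, by omega⟩
  rw [roundLength, hseg]
  simp only [hgain]
  generalize (K - 1).choose (j - 1) = C at *
  refine le_antisymm (Nat.sInf_le ?_) (le_csInf ⟨g, Or.inl le_rfl⟩ ?_)
  · have h := le_smul_ceilDiv hC (b := min (g * C) (F - a))
    rw [smul_eq_mul] at h
    rcases le_total (g * C) (F - a) with h1 | h1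
    · left
      rw [min_eq_left h1] at h ⊢
      exact Nat.le_of_mul_le_mul_left (by linarith) hC
    · right
      rw [min_eq_right h1] at h ⊢
      have h2 : (F - a) ⌈/⌉ C ≤ g := by
        rw [ceilDiv_le_iff_le_smul hC, smul_eq_mul]; linarith
      intro _
      rw [min_eq_left h2]
      omega
  · rintro l hl
    rw [ceilDiv_le_iff_le_smul hC, smul_eq_mul]
    rcases hl with hl | hl
    · exact (min_le_left _ _).trans (by nlinarith)
    · refine (min_le_right _ _).trans ?_
      have h1 := hl k0
      have h2 : C * min l g ≤ C * l := Nat.mul_le_mul_left _ (min_le_left _ _)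
      omega

/-- Number of symbols of its requested file that each user has after the `m` iterations
`j = K, K - 1, …, K - m + 1`. -/
noncomputable def accAfter (Z : Caches K N n) (d : Fin K → Fin N) (F : ℕ) : ℕ → Fin K → ℕ
  | 0 => fun k => (Z k (d k)).card
  | m + 1 => fun k => accAfter Z d F m k +
      gain Z d (K - m) (roundLength Z d F (K - m) (accAfter Z d F m)) k

/-- Number of symbols that are sent of each message in iteration `j`, for `1 ≤ j ≤ K`. -/
noncomputable def incr (Z : Caches K N n) (d : Fin K → Fin N) (F j : ℕ) : ℕ :=
  roundLength Z d F j (accAfter Z d F (K - j))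

/-- Index set of the symbols that the server sends: for each set `S` of requesting users that
contains a leader, the first `incr` symbols of the message for `S`. -/
noncomputable def sent (Z : Caches K N n) (d : Fin K → Fin N) (F : ℕ) (U : Finset (Fin K)) :
    Finset (Σ _ : Finset (Fin K), ℕ) :=
  (univ.filter fun S : Finset (Fin K) => (S ∩ U).Nonempty).sigma
    fun S => range (incr Z d F S.card)

/-- Total number of symbols sent in the delivery phase. -/
noncomputable def load (Z : Caches K N n) (d : Fin K → Fin N) (F : ℕ) (U : Finset (Fin K)) : ℕ :=
  (sent Z d F U).card

/-- Worst-case normalized rate `max_d R(d)`, when `U d` are the leaders for the requests `d`. -/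
noncomputable def worstRate (Z : Caches K N n) (F : ℕ)
    (U : (Fin K → Fin N) → Finset (Fin K)) : ℝ :=
  ((univ.sup fun d => load Z d F (U d) : ℕ) : ℝ) / F

/-- The cache content of user `k`. -/
def cacheContent {𝔽 : Type} {F : ℕ} (enc : (Fin F → 𝔽) → (Fin n → 𝔽)) (Z : Caches K N n)
    (k : Fin K) (W : Fin N → Fin F → 𝔽) : (i : Fin N) → {t // t ∈ Z k i} → 𝔽 :=
  fun i t => enc (W i) t

/-- What the server sends: the symbol number `p` of the message for `S` is that of
`⊕_{k ∈ S} W'_{d_k, S \ {k}}`. In characteristic `2`, addition is the bitwise XOR. -/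
noncomputable def transmission {𝔽 : Type} [AddCommMonoid 𝔽] {F : ℕ}
    (enc : (Fin F → 𝔽) → (Fin n → 𝔽)) (Z : Caches K N n) (d : Fin K → Fin N)
    (U : Finset (Fin K)) (W : Fin N → Fin F → 𝔽) : {x // x ∈ sent Z d F U} → 𝔽 :=
  fun x => ∑ k ∈ x.1.1, paddedSymbol (enc (W (d k))) (segment Z (d k) (x.1.1.erase k)) x.1.2

/-- User `k` can recover its requested file from its cache and the transmission. -/
def CanDecode {𝔽 : Type} [AddCommMonoid 𝔽] {F : ℕ} (enc : (Fin F → 𝔽) → (Fin n → 𝔽))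
    (Z : Caches K N n) (d : Fin K → Fin N) (U : Finset (Fin K)) (k : Fin K) : Prop :=
  ∃ dec : ((i : Fin N) → {t // t ∈ Z k i} → 𝔽) → ({x // x ∈ sent Z d F U} → 𝔽) → (Fin F → 𝔽),
    ∀ W : Fin N → Fin F → 𝔽,
      dec (cacheContent enc Z k W) (transmission enc Z d U W) = W (d k)

end Delivery

/-! ### The rate formula -/

/-- `q = M / (r N)` -/
noncomputable def q (N : ℕ) (M r : ℝ) : ℝ := M / (r * N)

/-- The accumulation function `A(x)`, for `x ≥ 1`. -/
noncomputable def A (N K : ℕ) (M r : ℝ) (x : ℕ) : ℝ :=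
  M / N + ∑ j ∈ Icc x K,
    r * q N M r ^ (j - 1) * (1 - q N M r) ^ (K - j + 1) * ((K - 1).choose (j - 1) : ℝ)

/-- `s` is the index of the last iteration: `A(s+1) < 1 ≤ A(s)`. -/
def IsThreshold (N K : ℕ) (M r : ℝ) (s : ℕ) : Prop :=
  1 ≤ s ∧ s ≤ K ∧ A N K M r (s + 1) < 1 ∧ 1 ≤ A N K M r s

/-- The rate `R_dec`, with `J = min {N, K}`. -/
noncomputable def Rdec (N K : ℕ) (M r : ℝ) (s : ℕ) : ℝ :=
  (∑ j ∈ Icc (s + 1) K, r * q N M r ^ (j - 1) * (1 - q N M r) ^ (K - j + 1) *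
      ((K.choose j : ℝ) - ((K - min N K).choose j : ℝ))) +
    (1 - A N K M r (s + 1)) / ((K - 1).choose (s - 1) : ℝ) *
      ((K.choose s : ℝ) - ((K - min N K).choose s : ℝ))

end CodedCaching

/-! Threshold: `A` is antitone, `A(1) = r ≥ 1` by the binomial theorem, and `A(K+1) = M/N < 1`, so
`A` falls below `1` exactly once.

Decoding (`canDecode`): the messages for sets without leaders need not be sent. In characteristic
two, for every `B` the messages for `B \ V`, with `V` running over the leader sets inside `B`,
cancel in pairs (`sum_message_sdiff_eq_zero`). With `B = S ∪ U` this expresses the message for a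
leaderless `S` through messages for sets of the same size that contain leaders. Each user then
cancels the segments that it has cached. It ends with at least `F` coded symbols: either some round
brought all users to `F`, or every round was sent entirely and the user knows the whole coded file
(`le_card_knownPositions`).

Rate: everything that is sent is a function of the segment sizes. A given position lies in a given
segment with probability `p ^ |B| * (1 - p) ^ (K - |B|)`, where `p` is the cached fraction of a
coded file and tends to `q`. Two positions are negatively correlated, so the variance of a segment
size is at most the code length, and Chebyshev's inequality gives convergence in probability after
division by `F`. The remaining argument is deterministic: if the normalized segment sizes converge,
the users' symbol counts follow `min 1 (A j)` (`tendsto_accAfter_div`), which gives the limiting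
message lengths. The load depends on the leaders only through their number and is asymptotically
largest when `min N K` different files are requested. -/

namespace CodedCaching

/-! ### Monotonicity of `A` and uniqueness of the threshold -/

section Threshold

variable {N K : ℕ} {M r : ℝ}

theorem q_nonneg (hM0 : 0 ≤ M) (hr : 1 ≤ r) : 0 ≤ q N M r := by
  unfold q; positivity

theorem q_le_one (hN : 1 ≤ N) (hMN : M ≤ N) (hr : 1 ≤ r) : q N M r ≤ 1 := by
  have : (1 : ℝ) ≤ N := by exact_mod_cast hN
  unfold q
  rw [div_le_one (by positivity)]
  nlinarith

theorem mul_q (hN : 1 ≤ N) (hr : 1 ≤ r) : r * q N M r = M / N := by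
  have : (1 : ℝ) ≤ N := by exact_mod_cast hN
  unfold q
  field_simp

theorem A_last : A N K M r (K + 1) = M / N := by
  simp [A]

theorem A_eq_add {j : ℕ} (hj : j ≤ K) :
    A N K M r j = A N K M r (j + 1) +
      ((K - 1).choose (j - 1) : ℝ) * (r * q N M r ^ (j - 1) * (1 - q N M r) ^ (K - j + 1)) := by
  unfold A
  rw [← Finset.add_sum_Ioc_eq_sum_Icc hj, ← Finset.Icc_add_one_left_eq_Ioc]
  ring

theorem A_antitone (hN : 1 ≤ N) (hM0 : 0 ≤ M) (hMN : M ≤ N) (hr : 1 ≤ r) :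
    Antitone (A N K M r) := by
  intro x y hxy
  have h0 := q_nonneg (N := N) hM0 hr
  have h1 : 0 ≤ 1 - q N M r := sub_nonneg.2 (q_le_one hN hMN hr)
  unfold A
  gcongr

/-- The exponents of `q` and `1 - q` add up to `K`, one more than in the binomial expansion of `(q +
(1 - q)) ^ (K - 1)`. The sum is therefore `r * (1 - q)`, and the cached part `M / N = r * q`
completes it to `r`. -/
theorem A_one (hN : 1 ≤ N) (hK : 1 ≤ K) (hr : 1 ≤ r) : A N K M r 1 = r := by
  obtain ⟨K, rfl⟩ : ∃ k, K = k + 1 := ⟨K - 1, by omega⟩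
  have hb := add_pow (q N M r) (1 - q N M r) K
  have hsum : ∑ j ∈ Icc 1 (K + 1), r * q N M r ^ (j - 1) * (1 - q N M r) ^ (K + 1 - j + 1) *
      ((K + 1 - 1).choose (j - 1) : ℝ) = r * (1 - q N M r) := by
    rw [← Finset.Ico_add_one_right_eq_Icc, Finset.sum_Ico_eq_sum_range]
    rw [add_sub_cancel, one_pow] at hb
    refine Eq.trans ?_ (congrArg (r * (1 - q N M r) * ·) hb.symm |>.trans (mul_one _))
    rw [mul_sum]
    refine sum_congr (by simp) fun j hj => ?_
    have h1 : K + 1 - (1 + j) + 1 = K - j + 1 := by omega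
    rw [h1, pow_succ]
    simp
    ring
  rw [A, hsum, mul_sub, mul_q hN hr]
  ring

theorem existsUnique_isThreshold (hN : 1 ≤ N) (hK : 1 ≤ K) (hM0 : 0 ≤ M) (hMN : M < N)
    (hr : 1 ≤ r) : ∃! s, IsThreshold N K M r s := by
  have hA := A_antitone (K := K) hN hM0 hMN.le hr
  have hlast : A N K M r (K + 1) < 1 := by
    have : (0 : ℝ) < N := by exact_mod_cast hN
    rw [A_last, div_lt_one this]
    exact hMN
  classical
  -- The threshold is the least such `x`. It is not `0` because `A 1 = r ≥ 1`, and minimality gives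
  -- `1 ≤ A x`.
  have hex : ∃ x, A N K M r (x + 1) < 1 := ⟨K, hlast⟩
  have h1 : 1 ≤ Nat.find hex := by
    rw [Nat.one_le_iff_ne_zero]
    intro h0
    have h := Nat.find_spec hex
    rw [h0, zero_add, A_one hN hK hr] at h
    linarith
  refine ⟨Nat.find hex, ⟨h1, Nat.find_min' hex hlast, Nat.find_spec hex, ?_⟩, ?_⟩
  · have h := Nat.find_min hex (m := Nat.find hex - 1) (by omega)
    rw [Nat.sub_add_cancel h1] at h
    exact not_lt.1 h
  · rintro s ⟨hs1, -, hs2, hs3⟩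
    refine le_antisymm ?_ (Nat.find_min' hex hs2)
    by_contra! hlt
    have := Nat.find_spec hex
    have := hA (Nat.succ_le_of_lt hlt)
    simp only [Nat.succ_eq_add_one] at this
    linarith

end Threshold

/-! ### MDS codes and the cache sizes -/

section Code

open Polynomial in
/-- Evaluating the polynomial with given coefficients at distinct points is an MDS code. -/
theorem exists_isMDS {m n : ℕ} (h : m ≤ n) :
    ∃ (𝔽 : Type) (_ : Field 𝔽) (_ : Finite 𝔽) (_ : CharP 𝔽 2)
      (enc : (Fin m → 𝔽) →ₗ[𝔽] (Fin n → 𝔽)), IsMDS enc := by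
  have : Fact (Nat.Prime 2) := ⟨Nat.prime_two⟩
  -- The exponent `n + 1` is nonzero even for `n = 0`, and `2 ^ (n + 1) > n` leaves room for `n`
  -- distinct evaluation points.
  have hcard : Nat.card (GaloisField 2 (n + 1)) = 2 ^ (n + 1) := GaloisField.card 2 _ (by omega)
  have hfin : Finite (GaloisField 2 (n + 1)) := Nat.finite_of_card_ne_zero (by rw [hcard]; positivity)
  have : Fintype (GaloisField 2 (n + 1)) := Fintype.ofFinite _
  obtain ⟨x⟩ : Nonempty (Fin n ↪ GaloisField 2 (n + 1)) := by
    apply Function.Embedding.nonempty_of_card_le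
    rw [← Nat.card_eq_fintype_card, ← Nat.card_eq_fintype_card, hcard, Nat.card_fin]
    exact (Nat.lt_two_pow_self.trans (Nat.pow_lt_pow_right (by norm_num) (by omega))).le
  refine ⟨GaloisField 2 (n + 1), inferInstance, hfin, inferInstance,
    LinearMap.pi fun t => (Polynomial.leval (x t)).comp
      ((degreeLT (GaloisField 2 (n + 1)) m).subtype.comp (degreeLTEquiv _ m).symm.toLinearMap), h, ?_⟩
  intro T hT w w' hw
  apply (degreeLTEquiv (GaloisField 2 (n + 1)) m).symm.injective
  apply Subtype.ext
  refine Polynomial.eq_of_degrees_lt_of_eval_index_eq T (v := x) x.injective.injOn ?_ ?_ ?_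
  · rw [hT]; exact mem_degreeLT.1 (Subtype.coe_prop _)
  · rw [hT]; exact mem_degreeLT.1 (Subtype.coe_prop _)
  · intro t ht
    simpa using hw t ht

theorem le_codeLength {r : ℝ} (hr : 1 ≤ r) (F : ℕ) : F ≤ codeLength r F :=
  Nat.le_floor (by nlinarith [Nat.cast_nonneg (α := ℝ) F])

theorem cacheShare_le_codeLength {N : ℕ} {M r : ℝ} (hMN : M ≤ N) (hr : 1 ≤ r) (F : ℕ) :
    cacheShare M N F ≤ codeLength r F := by
  refine le_trans ?_ (le_codeLength hr F)
  refine Nat.floor_le_of_le ?_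
  refine div_le_of_le_mul₀ (by positivity) (by positivity) ?_
  rw [mul_comm]
  gcongr

theorem sum_card_cache_le {K' N F n : ℕ} {M : ℝ} (hM0 : 0 ≤ M)
    (ω : Placement K' N n (cacheShare M N F)) (k : Fin K') :
    ((∑ i, (ω k i).1.card : ℕ) : ℝ) ≤ M * F := by
  rcases Nat.eq_zero_or_pos N with rfl | hN
  · simp; positivity
  have hN : (0 : ℝ) < N := by exact_mod_cast hN
  have h : ∑ i, (ω k i).1.card = N * cacheShare M N F := by
    rw [sum_congr rfl fun i _ => (ω k i).2]; simp
  have h2 : (cacheShare M N F : ℝ) ≤ M * F / N := Nat.floor_le (by positivity)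
  rw [h]
  push_cast
  rw [le_div_iff₀ hN] at h2
  linarith

end Code

/-! ### Redundant messages and decodability -/

section Decoding

variable {K N n : ℕ}

/-- The `p`-th symbol of the message for the users in `S`. -/
def message {𝔽 : Type} [AddCommMonoid 𝔽] (w : Fin N → Fin n → 𝔽) (Z : Caches K N n)
    (d : Fin K → Fin N) (p : ℕ) (S : Finset (Fin K)) : 𝔽 :=
  ∑ k ∈ S, paddedSymbol (w (d k)) (segment Z (d k) (S.erase k)) p

theorem IsLeaderSet.card {d : Fin K → Fin N} {U : Finset (Fin K)} (hU : IsLeaderSet d U) :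
    U.card = (univ.image d).card := by
  rw [← hU.2, card_image_of_injOn hU.1]

/-- Exchanging a member of a leader set with a user with the same request. -/
theorem IsLeaderSet.exchange {d : Fin K → Fin N} {V : Finset (Fin K)} (hV : IsLeaderSet d V)
    {v k : Fin K} (hv : v ∈ V) (hk : k ∉ V) (hd : d v = d k) :
    IsLeaderSet d (insert k (V.erase v)) := by
  have himg : (insert k (V.erase v)).image d = univ.image d := by
    rw [image_insert, ← hd, ← image_insert, insert_erase hv]
    exact hV.2
  refine ⟨?_, himg⟩
  rw [← card_image_iff, himg, ← hV.card, card_insert_of_notMem (by simp [hk]),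
    card_erase_add_one hv]

theorem IsLeaderSet.exists_mem {d : Fin K → Fin N} {V : Finset (Fin K)} (hV : IsLeaderSet d V)
    (k : Fin K) : ∃ v ∈ V, d v = d k := by
  have : d k ∈ V.image d := by rw [hV.2]; exact mem_image_of_mem _ (mem_univ k)
  simpa using this

/-- In characteristic two, the messages for the sets `B \ V`, where `V` runs over the leader sets
contained in `B`, add up to zero. -/
theorem sum_message_sdiff_eq_zero {𝔽 : Type} [Ring 𝔽] [CharP 𝔽 2] (w : Fin N → Fin n → 𝔽)
    (Z : Caches K N n) (d : Fin K → Fin N) (p : ℕ) (B : Finset (Fin K))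
    (𝒱 : Finset (Finset (Fin K))) (h𝒱 : ∀ V, V ∈ 𝒱 ↔ V ⊆ B ∧ IsLeaderSet d V) :
    ∑ V ∈ 𝒱, message w Z d p (B \ V) = 0 := by
  unfold message
  rw [Finset.sum_sigma']
  -- For a summand `(V, k)` with `k ∈ B \ V`, the partner `v` is the leader in `V` with the same
  -- request as `k`. The choice is made total so that it can be used outside the index set.
  have hex : ∀ x : (Σ _ : Finset (Fin K), Fin K), ∃ v,
      x ∈ 𝒱.sigma (fun V => B \ V) → v ∈ x.1 ∧ d v = d x.2 := by
    intro x
    by_cases hx : x ∈ 𝒱.sigma (fun V => B \ V)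
    · obtain ⟨v, hv⟩ := ((h𝒱 x.1).1 (mem_sigma.1 hx).1).2.exists_mem x.2
      exact ⟨v, fun _ => hv⟩
    · exact ⟨x.2, fun h => absurd h hx⟩
  choose f hf using hex
  have hswap : ∀ (V : Finset (Fin K)) (k v : Fin K), V ⊆ B → k ∈ B → k ∉ V → v ∈ V →
      (B \ insert k (V.erase v)).erase v = (B \ V).erase k := by
    intro V k v hVB hkB hkV hvV
    ext x
    simp only [mem_erase, mem_sdiff, mem_insert]
    grind
  -- The summand `(V, k)` is paired with `(V - v + k, v)`. Both involve the same file, as `d v = d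
  -- k`, and the same segment, by `hswap`, so they cancel in characteristic two. There is no fixed
  -- point since `v ∈ V` and `k ∉ V`. Injectivity of `d` on the new leader set makes `k` the partner
  -- of `v`, so the map is an involution.
  refine Finset.sum_involution
    (fun x _ => (⟨insert x.2 (x.1.erase (f x)), f x⟩ : Σ _ : Finset (Fin K), Fin K)) ?_ ?_ ?_ ?_
  · rintro ⟨V, k⟩ hx
    obtain ⟨hv, hd⟩ := hf _ hx
    simp only [mem_sigma, mem_sdiff, h𝒱] at hx hv hd
    have := hswap V k (f ⟨V, k⟩) hx.1.1 hx.2.1 hx.2.2 hv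
    simp only [this, hd]
    exact CharTwo.add_self_eq_zero _
  · rintro ⟨V, k⟩ hx - heq
    obtain ⟨hv, hd⟩ := hf _ hx
    simp only [mem_sigma, mem_sdiff] at hx
    have : f ⟨V, k⟩ = k := by
      simpa using congrArg (fun y : (Σ _ : Finset (Fin K), Fin K) => y.2) heq
    rw [this] at hv
    exact hx.2.2 hv
  · rintro ⟨V, k⟩ hx
    obtain ⟨hv, hd⟩ := hf _ hx
    simp only [mem_sigma, mem_sdiff, h𝒱] at hx hv hd ⊢
    refine ⟨⟨?_, hx.1.2.exchange hv hx.2.2 hd⟩, hx.1.1 hv, ?_⟩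
    · exact insert_subset hx.2.1 ((erase_subset _ _).trans hx.1.1)
    · simp only [mem_insert, mem_erase, ne_eq, not_true_eq_false, false_and, or_false]
      rintro h
      exact hx.2.2 (h ▸ hv)
  · rintro ⟨V, k⟩ hx
    have hv' : ∀ hx' : (⟨insert k (V.erase (f ⟨V, k⟩)), f ⟨V, k⟩⟩ : Σ _ : Finset (Fin K), Fin K) ∈
        𝒱.sigma (fun V => B \ V), f ⟨insert k (V.erase (f ⟨V, k⟩)), f ⟨V, k⟩⟩ = k := by
      intro hx'
      obtain ⟨hv, hd⟩ := hf _ hx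
      obtain ⟨hv', hd'⟩ := hf _ hx'
      simp only [mem_sigma, mem_sdiff, h𝒱] at hx'
      exact hx'.1.2.1 hv' (mem_insert_self _ _) (hd'.trans hd)
    obtain ⟨hv, hd⟩ := hf _ hx
    simp only [mem_sigma, mem_sdiff, h𝒱] at hx hv hd hv'
    have hk : f ⟨insert k (V.erase (f ⟨V, k⟩)), f ⟨V, k⟩⟩ = k := by
      refine hv' ⟨⟨?_, hx.1.2.exchange hv hx.2.2 hd⟩, hx.1.1 hv, ?_⟩
      · exact insert_subset hx.2.1 ((erase_subset _ _).trans hx.1.1)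
      · simp only [mem_insert, mem_erase, ne_eq, not_true_eq_false, false_and, or_false]
        rintro h
        exact hx.2.2 (h ▸ hv)
    simp only [hk]
    congr 1
    rw [erase_insert (by simp [hx.2.2]), insert_erase hv]

/-- The messages for sets without leaders are determined by those for sets with leaders. -/
theorem message_eq_of_forall_leader {𝔽 : Type} [Ring 𝔽] [CharP 𝔽 2] {w w' : Fin N → Fin n → 𝔽}
    {Z : Caches K N n} {d : Fin K → Fin N} {p : ℕ} {U S : Finset (Fin K)} (hU : IsLeaderSet d U)
    (h : ∀ T : Finset (Fin K), T.card = S.card → (T ∩ U).Nonempty →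
      message w Z d p T = message w' Z d p T) :
    message w Z d p S = message w' Z d p S := by
  classical
  by_cases hS : (S ∩ U).Nonempty
  · exact h S rfl hS
  have hdisj : Disjoint S U := by
    rwa [disjoint_iff_inter_eq_empty, ← not_nonempty_iff_eq_empty]
  let 𝒱 := (S ∪ U).powerset.filter (IsLeaderSet d)
  have h𝒱 : ∀ V, V ∈ 𝒱 ↔ V ⊆ S ∪ U ∧ IsLeaderSet d V := by
    simp only [𝒱, mem_filter, mem_powerset, implies_true]
  have hU𝒱 : U ∈ 𝒱 := (h𝒱 U).2 ⟨subset_union_right, hU⟩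
  have h1 := sum_message_sdiff_eq_zero w Z d p (S ∪ U) 𝒱 h𝒱
  have h2 := sum_message_sdiff_eq_zero w' Z d p (S ∪ U) 𝒱 h𝒱
  rw [← add_sum_erase _ _ hU𝒱, union_sdiff_cancel_right hdisj] at h1 h2
  -- All leader sets have the same size, so each `(S ∪ U) \ V` has as many elements as `S`. If `V ≠
  -- U`, then `V` misses some `u ∈ U`, which is a leader in `(S ∪ U) \ V`.
  have h3 : ∑ V ∈ 𝒱.erase U, message w Z d p ((S ∪ U) \ V) =
      ∑ V ∈ 𝒱.erase U, message w' Z d p ((S ∪ U) \ V) := by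
    refine sum_congr rfl fun V hV => ?_
    rw [mem_erase, h𝒱] at hV
    have hcard : V.card = U.card := by rw [hU.card, hV.2.2.card]
    apply h
    · rw [card_sdiff_of_subset hV.2.1, card_union_of_disjoint hdisj]
      omega
    · obtain ⟨u, hu, huV⟩ : ∃ u ∈ U, u ∉ V := by
        by_contra! hsub
        exact hV.1 (eq_of_subset_of_card_le hsub hcard.le).symm
      exact ⟨u, by simp [hu, huV]⟩
  rw [h3] at h1
  exact add_right_cancel (h1.trans h2.symm)

/-- The positions of the first `l` symbols of the segment at the positions `T`. -/
def firstPositions (T : Finset (Fin n)) (l : ℕ) : Finset (Fin n) :=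
  (univ.filter fun p : Fin T.card => p.1 < l).map (T.orderEmbOfFin rfl).toEmbedding

theorem firstPositions_subset (T : Finset (Fin n)) (l : ℕ) : firstPositions T l ⊆ T := by
  intro t ht
  simp only [firstPositions, mem_map] at ht
  obtain ⟨p, -, rfl⟩ := ht
  exact T.orderEmbOfFin_mem rfl p

theorem card_firstPositions (T : Finset (Fin n)) (l : ℕ) :
    (firstPositions T l).card = min l T.card := by
  rw [firstPositions, card_map, Fin.card_filter_val_lt, min_comm]

theorem apply_eq_of_paddedSymbol {𝔽 : Type} [Zero 𝔽] {w w' : Fin n → 𝔽} {T : Finset (Fin n)}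
    {l : ℕ} (h : ∀ p < l, paddedSymbol w T p = paddedSymbol w' T p) :
    ∀ t ∈ firstPositions T l, w t = w' t := by
  intro t ht
  simp only [firstPositions, mem_map, mem_filter] at ht
  obtain ⟨p, ⟨-, hp⟩, rfl⟩ := ht
  have := h p hp
  simpa [paddedSymbol] using this

theorem paddedSymbol_congr {𝔽 : Type} [Zero 𝔽] {w w' : Fin n → 𝔽} {T : Finset (Fin n)}
    (h : ∀ t ∈ T, w t = w' t) (p : ℕ) : paddedSymbol w T p = paddedSymbol w' T p := by
  unfold paddedSymbol
  split_ifs with hp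
  · exact h _ (T.orderEmbOfFin_mem rfl _)
  · rfl

theorem segment_disjoint (Z : Caches K N n) (i : Fin N) {B B' : Finset (Fin K)} (h : B ≠ B') :
    Disjoint (segment Z i B) (segment Z i B') := by
  rw [disjoint_left]
  intro t ht hu
  simp only [segment, mem_filter, mem_univ, true_and] at ht hu
  exact h (ext fun k => by rw [← ht, hu])

/-- The positions of the symbols that user `k` can get when `l j` symbols of the messages of size
`j` are delivered. -/
def knownPositions (Z : Caches K N n) (d : Fin K → Fin N) (l : ℕ → ℕ) (k : Fin K) :
    Finset (Fin n) :=
  Z k (d k) ∪ (univ.filter fun S : Finset (Fin K) => k ∈ S).biUnion fun S =>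
    firstPositions (segment Z (d k) (S.erase k)) (l S.card)

/-- Nothing is counted twice: the segments for `S \ {k}` consist of symbols that user `k` has not
cached, and different sets `S` containing `k` give disjoint segments. -/
theorem card_knownPositions (Z : Caches K N n) (d : Fin K → Fin N) (l : ℕ → ℕ) (k : Fin K) :
    (knownPositions Z d l k).card =
      (Z k (d k)).card + ∑ j ∈ range (K + 1), gain Z d j (l j) k := by
  rw [knownPositions, card_union_of_disjoint, card_biUnion]
  · congr 1
    rw [← Finset.sum_fiberwise_of_maps_to (t := range (K + 1)) (g := Finset.card)]
    · refine sum_congr rfl fun j hj => ?_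
      rw [gain]
      refine sum_congr ?_ ?_
      · ext S; simp [and_comm, mem_powersetCard]
      · intro S hS
        rw [card_firstPositions]
        simp only [mem_filter, mem_powersetCard] at hS
        rw [hS.1.2]
    · intro S _
      have := card_le_univ S
      simp only [Fintype.card_fin] at this
      simp; omega
  · intro S hS S' hS' hne
    refine Disjoint.mono (firstPositions_subset _ _) (firstPositions_subset _ _)
      (segment_disjoint _ _ fun h => hne ?_)
    simp only [coe_filter, mem_univ, true_and, Set.mem_ofPred_eq] at hS hS'
    rw [← insert_erase hS, ← insert_erase hS', h]
  · rw [disjoint_left]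
    intro t ht ht'
    simp only [mem_biUnion] at ht'
    obtain ⟨S, -, hS⟩ := ht'
    have := firstPositions_subset _ _ hS
    simp only [segment, mem_filter] at this
    have := (this.2 k).1 ht
    simp at this

theorem roundLength_spec (Z : Caches K N n) (d : Fin K → Fin N) (F j : ℕ) (acc : Fin K → ℕ) :
    seg Z d j ≤ roundLength Z d F j acc ∨
      ∀ k, F ≤ acc k + gain Z d j (roundLength Z d F j acc) k :=
  Nat.sInf_mem (s := {l | seg Z d j ≤ l ∨ ∀ k, F ≤ acc k + gain Z d j l k}) ⟨_, Or.inl le_rfl⟩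

theorem card_segment_le_seg (Z : Caches K N n) (d : Fin K → Fin N) {S : Finset (Fin K)}
    {k : Fin K} (hk : k ∈ S) : (segment Z (d k) (S.erase k)).card ≤ seg Z d S.card :=
  (le_sup (f := fun k => (segment Z (d k) (S.erase k)).card) hk).trans
    (le_sup (f := fun S => S.sup fun k => (segment Z (d k) (S.erase k)).card)
      (mem_powersetCard.2 ⟨subset_univ S, rfl⟩))

theorem accAfter_eq_sum (Z : Caches K N n) (d : Fin K → Fin N) (F : ℕ) (k : Fin K) {m : ℕ}
    (hm : m ≤ K) : accAfter Z d F m k =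
      (Z k (d k)).card + ∑ i ∈ range m, gain Z d (K - i) (incr Z d F (K - i)) k := by
  induction m with
  | zero => simp [accAfter]
  | succ m ih =>
    rw [sum_range_succ, ← add_assoc, ← ih (by omega), accAfter, incr,
      show K - (K - m) = m by omega]

/-- There is no round `0`. This removes its spurious term from the sum over `range (K + 1)`. -/
theorem gain_zero (Z : Caches K N n) (d : Fin K → Fin N) (l : ℕ) (k : Fin K) :
    gain Z d 0 l k = 0 := by
  rw [gain]
  refine sum_eq_zero fun S hS => ?_
  simp only [mem_filter, mem_powersetCard, card_eq_zero] at hS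
  obtain ⟨⟨-, rfl⟩, h⟩ := hS
  simp at h

theorem card_knownPositions_incr (Z : Caches K N n) (d : Fin K → Fin N) (F : ℕ) (k : Fin K) :
    (knownPositions Z d (incr Z d F) k).card = accAfter Z d F K k := by
  rw [card_knownPositions, accAfter_eq_sum Z d F k le_rfl, sum_range_succ', gain_zero, add_zero,
    ← sum_range_reflect]
  congr 1
  refine sum_congr rfl fun i hi => ?_
  rw [mem_range] at hi
  rw [show K - 1 - i + 1 = K - i by omega]

theorem accAfter_mono (Z : Caches K N n) (d : Fin K → Fin N) (F : ℕ) (k : Fin K) :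
    Monotone fun m => accAfter Z d F m k :=
  monotone_nat_of_le_succ fun m => by simp [accAfter]

/-- At the end of the delivery, every user has enough symbols. -/
theorem le_card_knownPositions (Z : Caches K N n) (d : Fin K → Fin N) {F : ℕ} (hF : F ≤ n)
    (k : Fin K) : F ≤ (knownPositions Z d (incr Z d F) k).card := by
  -- If no round brings all users to `F` symbols, the second alternative of `roundLength_spec` fails
  -- in each round, so every round is sent entirely and user `k` learns all `n ≥ F` positions.
  by_cases h : ∃ m < K, ∀ k, F ≤ accAfter Z d F (m + 1) k
  · obtain ⟨m, hm, h⟩ := h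
    rw [card_knownPositions_incr]
    exact (h k).trans (accAfter_mono Z d F k hm)
  · push Not at h
    have hseg : ∀ S : Finset (Fin K), S.Nonempty → seg Z d S.card ≤ incr Z d F S.card := by
      intro S hS
      have h1 := card_pos.2 hS
      have h2 := card_le_univ S
      rw [Fintype.card_fin] at h2
      obtain ⟨k', hk'⟩ := h (K - S.card) (by omega)
      refine (roundLength_spec Z d F S.card (accAfter Z d F (K - S.card))).resolve_right fun hr => ?_
      have := hr k'
      rw [accAfter, show K - (K - S.card) = S.card by omega] at hk'
      exact absurd hk' (not_lt.2 this)
    have huniv : knownPositions Z d (incr Z d F) k = univ := by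
      rw [eq_univ_iff_forall]
      intro t
      rw [knownPositions, mem_union]
      by_cases ht : t ∈ Z k (d k)
      · exact Or.inl ht
      right
      -- The position `t` lies in the segment of the users that have cached it, which the message
      -- for `insert k B` delivers to `k`.
      let B := univ.filter fun k' => t ∈ Z k' (d k)
      have hkB : k ∉ B := by simpa [B] using ht
      rw [mem_biUnion]
      refine ⟨insert k B, by simp, ?_⟩
      have hfull : firstPositions (segment Z (d k) ((insert k B).erase k))
          (incr Z d F (insert k B).card) = segment Z (d k) ((insert k B).erase k) := by
        refine eq_of_subset_of_card_le (firstPositions_subset _ _) ?_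
        rw [card_firstPositions]
        exact le_min ((card_segment_le_seg Z d (mem_insert_self k B)).trans
          (hseg _ ⟨k, mem_insert_self k B⟩)) le_rfl
      rw [hfull, erase_insert hkB]
      simp [segment, B]
    rw [huniv]
    simpa using hF

/-- A decoder exists once the observations of user `k` determine its file: it may return that of any
library consistent with them. So two libraries with equal observations are compared. -/
theorem canDecode {𝔽 : Type} [Ring 𝔽] [CharP 𝔽 2] {F : ℕ}
    {enc : (Fin F → 𝔽) → (Fin n → 𝔽)} (henc : IsMDS enc) (Z : Caches K N n)
    (d : Fin K → Fin N) {U : Finset (Fin K)} (hU : IsLeaderSet d U) (k : Fin K) :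
    CanDecode enc Z d U k := by
  classical
  suffices h : ∀ W W' : Fin N → Fin F → 𝔽, cacheContent enc Z k W = cacheContent enc Z k W' →
      transmission enc Z d U W = transmission enc Z d U W' → W (d k) = W' (d k) by
    refine ⟨fun c x => if hW : ∃ W, cacheContent enc Z k W = c ∧ transmission enc Z d U W = x
      then hW.choose (d k) else 0, fun W => ?_⟩
    have hW : ∃ W', cacheContent enc Z k W' = cacheContent enc Z k W ∧
      transmission enc Z d U W' = transmission enc Z d U W := ⟨W, rfl, rfl⟩
    simp only [dif_pos hW]
    exact h _ _ hW.choose_spec.1 hW.choose_spec.2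
  intro W W' hc ht
  have hcache : ∀ i, ∀ t ∈ Z k i, enc (W i) t = enc (W' i) t := fun i t hti =>
    congrFun (congrFun hc i) ⟨t, hti⟩
  -- The number of symbols sent depends only on `|S|`, so the `p`-th symbol of every leader message
  -- needed to reconstruct that of `S` was sent as well.
  have hmsg : ∀ (S : Finset (Fin K)) (p : ℕ), p < incr Z d F S.card →
      message (fun i => enc (W i)) Z d p S = message (fun i => enc (W' i)) Z d p S := by
    intro S p hp
    refine message_eq_of_forall_leader hU fun T hT hTU => ?_
    exact congrFun ht ⟨⟨T, p⟩, by simp [sent, hTU, hT, hp]⟩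
  have hpad : ∀ (S : Finset (Fin K)), k ∈ S → ∀ p < incr Z d F S.card,
      paddedSymbol (enc (W (d k))) (segment Z (d k) (S.erase k)) p =
        paddedSymbol (enc (W' (d k))) (segment Z (d k) (S.erase k)) p := by
    intro S hkS p hp
    have h := hmsg S p hp
    unfold message at h
    rw [← add_sum_erase _ _ hkS, ← add_sum_erase _ _ hkS] at h
    refine add_right_cancel (h.trans (congrArg _ ?_))
    -- For `k' ≠ k` the user `k` belongs to `S \ {k'}`, so it has cached that segment and can
    -- subtract it.
    refine sum_congr rfl fun k' hk' => (paddedSymbol_congr (fun t ht => ?_) p).symm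
    simp only [segment, mem_filter, mem_univ, true_and] at ht
    refine hcache _ _ ((ht k).2 ?_)
    rw [mem_erase] at hk' ⊢
    exact ⟨hk'.1.symm, hkS⟩
  have hknown : ∀ t ∈ knownPositions Z d (incr Z d F) k, enc (W (d k)) t = enc (W' (d k)) t := by
    intro t ht
    simp only [knownPositions, mem_union, mem_biUnion, mem_filter, mem_univ, true_and] at ht
    rcases ht with ht | ⟨S, hkS, ht⟩
    · exact hcache _ _ ht
    · exact apply_eq_of_paddedSymbol (hpad S hkS) t ht
  obtain ⟨T, hTs, hT⟩ := exists_subset_card_eq (le_card_knownPositions Z d henc.1 k)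
  exact henc.2 T hT _ _ fun t ht => hknown t (hTs ht)

end Decoding

/-! ### Deterministic limits of round lengths and symbol counts -/

section Limit

open Filter Topology

theorem card_filter_mem_powersetCard {K : ℕ} (k : Fin K) {j : ℕ} (hj : 1 ≤ j) :
    ((powersetCard j (univ : Finset (Fin K))).filter (fun S => k ∈ S)).card =
      (K - 1).choose (j - 1) := by
  have h := card_powersetCard (j - 1) ((univ : Finset (Fin K)).erase k)
  rw [card_erase_of_mem (mem_univ k), card_univ, Fintype.card_fin] at h
  rw [← h]
  refine card_nbij' (fun S => S.erase k) (insert k) ?_ ?_ ?_ ?_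
  · intro S hS
    simp only [coe_filter, Set.mem_ofPred_eq, mem_powersetCard, SetLike.mem_coe] at hS ⊢
    exact ⟨erase_subset_erase k (subset_univ S), by rw [card_erase_of_mem hS.2, hS.1.2]⟩
  · intro T hT
    simp only [coe_filter, Set.mem_ofPred_eq, mem_powersetCard, SetLike.mem_coe] at hT ⊢
    have hk : k ∉ T := fun h => by simpa using hT.1 h
    exact ⟨⟨subset_univ _, by rw [card_insert_of_notMem hk, hT.2]; omega⟩, mem_insert_self k T⟩
  · intro S hS
    simp only [coe_filter, Set.mem_ofPred_eq] at hS
    exact insert_erase hS.2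
  · intro T hT
    simp only [mem_powersetCard, SetLike.mem_coe] at hT
    exact erase_insert fun h => by simpa using hT.1 h

variable {K N n : ℕ}

theorem gain_le (Z : Caches K N n) (d : Fin K → Fin N) {j : ℕ} (hj : 1 ≤ j) (l : ℕ) (k : Fin K) :
    gain Z d j l k ≤ (K - 1).choose (j - 1) * l := by
  rw [gain, ← card_filter_mem_powersetCard k hj, ← smul_eq_mul]
  exact sum_le_card_nsmul _ _ _ fun S _ => min_le_left _ _

theorem gain_eq_of_le (Z : Caches K N n) (d : Fin K → Fin N) {j l : ℕ} (hj : 1 ≤ j)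
    (hl : ∀ S : Finset (Fin K), S.card = j → ∀ k ∈ S, l ≤ (segment Z (d k) (S.erase k)).card)
    (k : Fin K) : gain Z d j l k = (K - 1).choose (j - 1) * l := by
  rw [gain, ← card_filter_mem_powersetCard k hj, ← smul_eq_mul, ← sum_const]
  refine sum_congr rfl fun S hS => ?_
  rw [mem_filter, mem_powersetCard] at hS
  exact min_eq_left (hl S hS.1.2 k hS.2)

variable {ι : Type*} {L : Filter ι} {n F : ι → ℕ} {Z : ∀ x, Caches K N (n x)}

/-- When the segments all have size about `g * F` and the users hold about `a * F` symbols, this is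
the exact formula for equal sizes, up to `o(F)`. The lower bound tests one pair `k₀ ∈ S₀`; the upper
bound exhibits an admissible length `⌊b' * F⌋₊`. -/
theorem tendsto_roundLength_div (d : Fin K → Fin N) {j : ℕ} (hj : 1 ≤ j) (hjK : j ≤ K)
    {acc : ι → Fin K → ℕ} {a g : ℝ} (hF : Tendsto F L atTop)
    (hacc : ∀ k, Tendsto (fun x => (acc x k : ℝ) / F x) L (𝓝 a))
    (hg : ∀ S : Finset (Fin K), S.card = j → ∀ k ∈ S,
      Tendsto (fun x => ((segment (Z x) (d k) (S.erase k)).card : ℝ) / F x) L (𝓝 g)) :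
    Tendsto (fun x => (roundLength (Z x) d (F x) j (acc x) : ℝ) / F x) L
      (𝓝 (min g (max 0 (1 - a) / ((K - 1).choose (j - 1) : ℝ)))) := by
  set C := (K - 1).choose (j - 1) with hCdef
  have hC : 0 < C := Nat.choose_pos (by omega)
  have hCR : (0 : ℝ) < C := by exact_mod_cast hC
  have hFR : Tendsto (fun x => (F x : ℝ)) L atTop := tendsto_natCast_atTop_atTop.comp hF
  have hFpos : ∀ᶠ x in L, (0 : ℝ) < F x := hFR.eventually_gt_atTop 0
  obtain ⟨S₀, -, hS₀⟩ := exists_subset_card_eq (s := (univ : Finset (Fin K))) (n := j)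
    (by simpa using hjK)
  obtain ⟨k₀, hk₀⟩ := card_pos.1 (by omega : 0 < S₀.card)
  have hall : ∀ P : Finset (Fin K) → Fin K → ι → Prop,
      (∀ S : Finset (Fin K), S.card = j → ∀ k ∈ S, ∀ᶠ x in L, P S k x) →
      ∀ᶠ x in L, ∀ S : Finset (Fin K), S.card = j → ∀ k ∈ S, P S k x := by
    intro P hP
    simp only [eventually_all]
    exact hP
  have hupper : ∀ b, g < b →
      ∀ᶠ x in L, (roundLength (Z x) d (F x) j (acc x) : ℝ) / F x < b := by
    intro b hb
    obtain ⟨b', hb', hbb'⟩ := exists_between hb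
    filter_upwards [hFpos, hall _ fun S hS k hk => (hg S hS k hk).eventually_lt_const hb']
      with x hx hcard
    have hle : ∀ S : Finset (Fin K), S.card = j → ∀ k ∈ S,
        ((segment (Z x) (d k) (S.erase k)).card : ℝ) ≤ b' * F x := fun S hS k hk =>
      ((div_lt_iff₀ hx).1 (hcard S hS k hk)).le
    have h0 : 0 ≤ b' * F x := (Nat.cast_nonneg _).trans (hle S₀ hS₀ k₀ hk₀)
    have hseg : seg (Z x) d j ≤ ⌊b' * F x⌋₊ :=
      Finset.sup_le fun S hS => Finset.sup_le fun k hk =>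
        Nat.le_floor (hle S (mem_powersetCard.1 hS).2 k hk)
    have hrl : roundLength (Z x) d (F x) j (acc x) ≤ ⌊b' * F x⌋₊ := Nat.sInf_le (Or.inl hseg)
    rw [div_lt_iff₀ hx]
    calc (roundLength (Z x) d (F x) j (acc x) : ℝ) ≤ ⌊b' * F x⌋₊ := by exact_mod_cast hrl
      _ ≤ b' * F x := Nat.floor_le h0
      _ < b * F x := by gcongr
  refine tendsto_order.2 ⟨fun b hb => ?_, fun b hb => ?_⟩
  · have hlim : Tendsto (fun x => min (((segment (Z x) (d k₀) (S₀.erase k₀)).card : ℝ) / F x)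
        (max 0 (1 - (acc x k₀ : ℝ) / F x) / (C : ℝ))) L (𝓝 (min g (max 0 (1 - a) / (C : ℝ)))) :=
      (hg S₀ hS₀ k₀ hk₀).min
        ((tendsto_const_nhds.max (tendsto_const_nhds.sub (hacc k₀))).div_const _)
    filter_upwards [hFpos, hlim.eventually_const_lt hb] with x hx hbx
    refine hbx.trans_le ?_
    rcases roundLength_spec (Z x) d (F x) j (acc x) with h | h
    · refine (min_le_left _ _).trans ?_
      have := card_segment_le_seg (Z x) d hk₀
      rw [hS₀] at this
      gcongr
      exact this.trans h
    · refine (min_le_right _ _).trans ?_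
      have h1 := (h k₀).trans (Nat.add_le_add_left (gain_le (Z x) d hj _ k₀) _)
      have h2 : (F x : ℝ) ≤ acc x k₀ + C * roundLength (Z x) d (F x) j (acc x) := by
        exact_mod_cast h1
      rw [div_le_iff₀ hCR]
      refine max_le (by positivity) ?_
      rw [sub_le_iff_le_add, div_mul_eq_mul_div, ← add_div, le_div_iff₀ hx]
      linarith
  · rcases lt_or_ge g b with hgb | hbg
    · exact hupper b hgb
    set β := max 0 (1 - a) / (C : ℝ) with hβ
    have hβb : β < b := (min_lt_iff.1 hb).resolve_left (not_lt.2 hbg)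
    have hβ0 : 0 ≤ β := by positivity
    obtain ⟨b', hβb', hbb'⟩ := exists_between hβb
    -- The term `C / F x` pays for rounding `b' * F x` down in each of the `C` messages. Since `b' <
    -- b ≤ g`, the rounded length is eventually below every segment size, so the gain is exactly `C`
    -- times it.
    have hlim : ∀ k, Tendsto (fun x => (acc x k : ℝ) / F x + C * b' - C / F x) L
        (𝓝 (a + C * b' - 0)) := fun k =>
      ((hacc k).add_const _).sub (hFR.const_div_atTop (C : ℝ))
    have h1 : 1 < a + C * b' - 0 := by
      have : max 0 (1 - a) < b' * C := (div_lt_iff₀ hCR).1 hβb'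
      have := le_max_right 0 (1 - a)
      linarith
    filter_upwards [hFpos,
      hall _ fun S hS k hk => (hg S hS k hk).eventually_const_lt (hbb'.trans_le hbg),
      eventually_all.2 fun k => (hlim k).eventually_const_lt h1] with x hx hcard hk
    have hb'F : 0 ≤ b' * F x := mul_nonneg (hβ0.trans hβb'.le) hx.le
    have hgain := gain_eq_of_le (Z x) d (l := ⌊b' * F x⌋₊) hj fun S hS k hk => by
      have := (lt_div_iff₀ hx).1 (hcard S hS k hk)
      exact_mod_cast (Nat.floor_le hb'F).trans this.le
    have hrl : roundLength (Z x) d (F x) j (acc x) ≤ ⌊b' * F x⌋₊ := by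
      refine Nat.sInf_le (Or.inr fun k => ?_)
      rw [hgain, ← Nat.cast_le (α := ℝ)]
      push_cast
      have h2 := hk k
      have h3 := Nat.lt_floor_add_one (b' * F x)
      have h4 : (F x : ℝ) < acc x k + C * (b' * F x) - C := by
        have h5 : (acc x k : ℝ) / F x + C * b' - C / F x =
            (acc x k + C * (b' * F x) - C) / F x := by field_simp
        rwa [h5, one_lt_div hx] at h2
      nlinarith
    rw [div_lt_iff₀ hx]
    calc (roundLength (Z x) d (F x) j (acc x) : ℝ) ≤ ⌊b' * F x⌋₊ := by exact_mod_cast hrl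
      _ ≤ b' * F x := Nat.floor_le hb'F
      _ < b * F x := by gcongr

theorem tendsto_gain_div (d : Fin K → Fin N) {j : ℕ} (hj : 1 ≤ j) {l : ι → ℕ} {b g : ℝ}
    (hl : Tendsto (fun x => (l x : ℝ) / F x) L (𝓝 b))
    (hg : ∀ S : Finset (Fin K), S.card = j → ∀ k ∈ S,
      Tendsto (fun x => ((segment (Z x) (d k) (S.erase k)).card : ℝ) / F x) L (𝓝 g))
    (k : Fin K) :
    Tendsto (fun x => (gain (Z x) d j (l x) k : ℝ) / F x) L
      (𝓝 (((K - 1).choose (j - 1) : ℝ) * min b g)) := by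
  rw [← card_filter_mem_powersetCard k hj, ← nsmul_eq_mul, ← sum_const]
  have : ∀ x, (gain (Z x) d j (l x) k : ℝ) / F x =
      ∑ S ∈ (powersetCard j univ).filter (fun S => k ∈ S),
        min ((l x : ℝ) / F x) (((segment (Z x) (d k) (S.erase k)).card : ℝ) / F x) := by
    intro x
    rw [gain, Nat.cast_sum, sum_div]
    refine sum_congr rfl fun S _ => ?_
    rw [Nat.cast_min, min_div_div_right (Nat.cast_nonneg _)]
  simp only [this]
  refine tendsto_finsetSum _ fun S hS => hl.min ?_
  rw [mem_filter, mem_powersetCard] at hS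
  exact hg S hS.1.2 k hS.2

section Incr

variable {M r : ℝ}

theorem tendsto_card_segment_erase_div {j : ℕ}
    (hseg : ∀ i B, Tendsto (fun x => ((segment (Z x) i B).card : ℝ) / F x) L
      (𝓝 (r * q N M r ^ B.card * (1 - q N M r) ^ (K - B.card))))
    (d : Fin K → Fin N) (S : Finset (Fin K))
    (hS : S.card = j) (k : Fin K) (hk : k ∈ S) :
    Tendsto (fun x => ((segment (Z x) (d k) (S.erase k)).card : ℝ) / F x) L
      (𝓝 (r * q N M r ^ (j - 1) * (1 - q N M r) ^ (K - j + 1))) := by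
  have h := hseg (d k) (S.erase k)
  have h1 := card_pos.2 ⟨k, hk⟩
  have h2 := card_le_univ S
  rw [Fintype.card_fin] at h2
  rwa [card_erase_of_mem hk, hS, show K - (j - 1) = K - j + 1 by omega] at h

/-- Induction on the rounds: with `C` the number of messages useful to a user, round `j` adds `min
(C * g) (max 0 (1 - a))` to `a = min 1 (A (j + 1))`. As `A j = A (j + 1) + C * g`, this is the
recursion of `A` truncated at `1`. -/
theorem tendsto_accAfter_div (hN : 1 ≤ N) (hM0 : 0 ≤ M) (hMN : M ≤ N) (hr : 1 ≤ r)
    (hF : Tendsto F L atTop)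
    (hcache : ∀ k i, Tendsto (fun x => ((Z x k i).card : ℝ) / F x) L (𝓝 (M / N)))
    (hseg : ∀ i B, Tendsto (fun x => ((segment (Z x) i B).card : ℝ) / F x) L
      (𝓝 (r * q N M r ^ B.card * (1 - q N M r) ^ (K - B.card))))
    (d : Fin K → Fin N) {m : ℕ} (hm : m ≤ K) (k : Fin K) :
    Tendsto (fun x => (accAfter (Z x) d (F x) m k : ℝ) / F x) L
      (𝓝 (min 1 (A N K M r (K - m + 1)))) := by
  have hN' : (0 : ℝ) < N := by exact_mod_cast hN
  have h0 := q_nonneg (N := N) hM0 hr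
  have h1 : 0 ≤ 1 - q N M r := sub_nonneg.2 (q_le_one hN hMN hr)
  induction m generalizing k with
  | zero =>
    rw [Nat.sub_zero, A_last, min_eq_right ((div_le_one hN').2 hMN)]
    exact hcache k (d k)
  | succ m ih =>
    have hsegj := tendsto_card_segment_erase_div (j := K - m) hseg d
    have hl := tendsto_roundLength_div d (by omega : 1 ≤ K - m) (by omega) hF
      (ih (by omega)) hsegj
    have hga := tendsto_gain_div d (by omega : 1 ≤ K - m) hl hsegj k
    have := (ih (by omega) k).add hga
    simp only [accAfter, Nat.cast_add, add_div]
    convert this using 2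
    rw [show K - (m + 1) + 1 = K - m by omega, A_eq_add (Nat.sub_le K m)]
    have hC : 0 < ((K - 1).choose (K - m - 1) : ℝ) := by
      exact_mod_cast Nat.choose_pos (by omega)
    have hg : 0 ≤ r * q N M r ^ (K - m - 1) * (1 - q N M r) ^ (K - (K - m) + 1) := by positivity
    generalize A N K M r (K - m + 1) = a at *
    generalize r * q N M r ^ (K - m - 1) * (1 - q N M r) ^ (K - (K - m) + 1) = g at *
    generalize ((K - 1).choose (K - m - 1) : ℝ) = C at *
    rw [min_eq_left (min_le_left _ _), mul_min_of_nonneg _ _ hC.le, mul_div_cancel₀ _ hC.ne']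
    have hCg : 0 ≤ C * g := by positivity
    rcases le_total 1 a with ha | ha
    · rw [min_eq_left ha, sub_self, max_self, min_eq_right hCg, min_eq_left (by linarith)]
      ring
    · rw [min_eq_right ha, max_eq_right (by linarith), ← min_add_add_left, min_comm]
      ring_nf

/-- The normalized length of the messages of iteration `j` converges. -/
theorem tendsto_incr_div (hN : 1 ≤ N) (hM0 : 0 ≤ M) (hMN : M ≤ N) (hr : 1 ≤ r)
    (hF : Tendsto F L atTop)
    (hcache : ∀ k i, Tendsto (fun x => ((Z x k i).card : ℝ) / F x) L (𝓝 (M / N)))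
    (hseg : ∀ i B, Tendsto (fun x => ((segment (Z x) i B).card : ℝ) / F x) L
      (𝓝 (r * q N M r ^ B.card * (1 - q N M r) ^ (K - B.card))))
    (d : Fin K → Fin N) {j : ℕ} (hj : 1 ≤ j) (hjK : j ≤ K) :
    Tendsto (fun x => (incr (Z x) d (F x) j : ℝ) / F x) L
      (𝓝 (min (r * q N M r ^ (j - 1) * (1 - q N M r) ^ (K - j + 1))
        (max 0 (1 - min 1 (A N K M r (j + 1))) / ((K - 1).choose (j - 1) : ℝ)))) := by
  have h := tendsto_roundLength_div d hj hjK hF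
    (fun k => tendsto_accAfter_div hN hM0 hMN hr hF hcache hseg d (Nat.sub_le K j) k)
    (tendsto_card_segment_erase_div hseg d)
  rwa [show K - (K - j) = j by omega] at h

end Incr

end Limit

/-! ### Number of symbols sent and the worst requests -/

section Load

open Filter Topology

variable {K N n : ℕ}

theorem card_filter_inter_nonempty (U : Finset (Fin K)) (j : ℕ) :
    (((powersetCard j (univ : Finset (Fin K))).filter fun S => (S ∩ U).Nonempty).card : ℝ) =
      (K.choose j : ℝ) - ((K - U.card).choose j : ℝ) := by
  have h1 := card_filter_add_card_filter_not (s := powersetCard j (univ : Finset (Fin K)))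
    (fun S => (S ∩ U).Nonempty)
  have h2 : (powersetCard j (univ : Finset (Fin K))).filter (fun S => ¬ (S ∩ U).Nonempty) =
      powersetCard j Uᶜ := by
    ext S
    simp only [mem_filter, mem_powersetCard, subset_univ, true_and, not_nonempty_iff_eq_empty,
      ← disjoint_iff_inter_eq_empty, subset_compl_iff_disjoint_right]
    tauto
  rw [h2, card_powersetCard, card_powersetCard, card_compl, card_univ, Fintype.card_fin] at h1
  rw [← h1]
  push_cast
  ring

/-- The leaders enter only through `U.card`, the number of different requests; hence the uniformity
over their choice. -/
theorem load_eq_sum (Z : Caches K N n) (d : Fin K → Fin N) (F : ℕ) (U : Finset (Fin K)) :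
    (load Z d F U : ℝ) = ∑ j ∈ Icc 1 K,
      (incr Z d F j : ℝ) * ((K.choose j : ℝ) - ((K - U.card).choose j : ℝ)) := by
  rw [load, sent, card_sigma]
  simp only [card_range]
  rw [← Finset.sum_fiberwise_of_maps_to (t := Icc 1 K) (g := Finset.card), Nat.cast_sum]
  · refine sum_congr rfl fun j _ => ?_
    rw [← card_filter_inter_nonempty]
    have : ((univ.filter fun S : Finset (Fin K) => (S ∩ U).Nonempty).filter fun S => S.card = j) =
        (powersetCard j (univ : Finset (Fin K))).filter fun S => (S ∩ U).Nonempty := by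
      ext S
      simp [mem_powersetCard, and_comm]
    rw [this, sum_congr rfl (g := fun _ => incr Z d F j), sum_const, smul_eq_mul, mul_comm]
    · push_cast; rfl
    · intro S hS
      rw [(mem_powersetCard.1 (mem_filter.1 hS).1).2]
  · intro S hS
    have h1 : 0 < S.card := card_pos.2 ((mem_filter.1 hS).2.mono inter_subset_left)
    have h2 := card_le_univ S
    rw [Fintype.card_fin] at h2
    exact mem_Icc.2 ⟨h1, h2⟩

theorem exists_card_image_eq (hN : 1 ≤ N) :
    ∃ d : Fin K → Fin N, (univ.image d).card = min N K := by
  refine ⟨fun k => ⟨min k.1 (N - 1), by omega⟩, ?_⟩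
  have : (univ.image fun k : Fin K => (⟨min k.1 (N - 1), by omega⟩ : Fin N)) =
      (univ : Finset (Fin (min N K))).image (Fin.castLE (min_le_left N K)) := by
    ext i
    simp only [mem_image, mem_univ, true_and, Fin.ext_iff, Fin.val_castLE]
    constructor
    · rintro ⟨k, hk⟩
      exact ⟨⟨i.1, by omega⟩, rfl⟩
    · rintro ⟨x, hx⟩
      exact ⟨⟨x.1, by omega⟩, by simp only; omega⟩
  rw [this, card_image_of_injective _ (Fin.castLE_injective _), card_univ, Fintype.card_fin]

variable {ι : Type*} {L : Filter ι} {n F : ι → ℕ} {Z : ∀ x, Caches K N (n x)}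

/-- The limit of the normalized length of the messages of iteration `j`, if `s` is the index of the
last iteration. -/
noncomputable def limitLength (N K : ℕ) (M r : ℝ) (s j : ℕ) : ℝ :=
  if s < j then r * q N M r ^ (j - 1) * (1 - q N M r) ^ (K - j + 1)
  else if j = s then (1 - A N K M r (s + 1)) / ((K - 1).choose (s - 1) : ℝ) else 0

/-- By `A_eq_add`, a full round `j` fits into the remaining demand `1 - A (j + 1)` exactly when `A j
≤ 1`. This holds for `j > s`; round `s` meets the demand, possibly in part; for `j < s` no demand is
left since `A (j + 1) ≥ A s ≥ 1`. -/
theorem min_eq_limitLength {M r : ℝ} (hN : 1 ≤ N) (hM0 : 0 ≤ M) (hMN : M ≤ N) (hr : 1 ≤ r)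
    {s j : ℕ} (hs : IsThreshold N K M r s) (hj : 1 ≤ j) (hjK : j ≤ K) :
    min (r * q N M r ^ (j - 1) * (1 - q N M r) ^ (K - j + 1))
      (max 0 (1 - min 1 (A N K M r (j + 1))) / ((K - 1).choose (j - 1) : ℝ)) =
      limitLength N K M r s j := by
  have hA := A_antitone (K := K) hN hM0 hMN hr
  have h0 := q_nonneg (N := N) hM0 hr
  have h1 : 0 ≤ 1 - q N M r := sub_nonneg.2 (q_le_one hN hMN hr)
  have hC : 0 < ((K - 1).choose (j - 1) : ℝ) := by
    exact_mod_cast Nat.choose_pos (by omega)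
  obtain ⟨hs1, hsK, hs2, hs3⟩ := hs
  have hstep := A_eq_add (N := N) (M := M) (r := r) hjK
  unfold limitLength
  rcases lt_trichotomy s j with h | rfl | h
  · have hAj : A N K M r j ≤ A N K M r (s + 1) := hA h
    have hAj' : A N K M r (j + 1) ≤ A N K M r j := hA (by omega)
    rw [if_pos h, min_eq_right (by linarith : A N K M r (j + 1) ≤ 1), max_eq_right (by linarith),
      min_eq_left]
    rw [le_div_iff₀ hC]
    linarith
  · rw [if_neg (lt_irrefl _), if_pos rfl, min_eq_right hs2.le, max_eq_right (by linarith),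
      min_eq_right]
    rw [div_le_iff₀ hC]
    linarith
  · have hAj : A N K M r s ≤ A N K M r (j + 1) := hA h
    rw [if_neg (by omega), if_neg (by omega), min_eq_left (hs3.trans hAj), sub_self, max_self,
      zero_div, min_eq_right (by positivity)]

theorem limitLength_nonneg {M r : ℝ} (hN : 1 ≤ N) (hM0 : 0 ≤ M) (hMN : M ≤ N) (hr : 1 ≤ r)
    {s : ℕ} (hs : IsThreshold N K M r s) (j : ℕ) : 0 ≤ limitLength N K M r s j := by
  have h0 := q_nonneg (N := N) hM0 hr
  have h1 : 0 ≤ 1 - q N M r := sub_nonneg.2 (q_le_one hN hMN hr)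
  have h2 : 0 ≤ 1 - A N K M r (s + 1) := sub_nonneg.2 hs.2.2.1.le
  unfold limitLength
  split_ifs <;> positivity

theorem sum_limitLength {M r : ℝ} {s : ℕ} (hs : IsThreshold N K M r s) :
    ∑ j ∈ Icc 1 K, limitLength N K M r s j *
      ((K.choose j : ℝ) - ((K - min N K).choose j : ℝ)) = Rdec N K M r s := by
  obtain ⟨hs1, hsK, -, -⟩ := hs
  have hsub : Icc s K ⊆ Icc 1 K := Icc_subset_Icc_left hs1
  rw [← sum_subset hsub, ← Finset.add_sum_Ioc_eq_sum_Icc hsK, ← Finset.Icc_add_one_left_eq_Ioc,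
    add_comm, Rdec]
  · congr 1
    · refine sum_congr rfl fun j hj => ?_
      rw [mem_Icc] at hj
      rw [limitLength, if_pos (by omega)]
    · simp [limitLength]
  · intro j hj hj'
    rw [mem_Icc] at hj hj'
    rw [limitLength, if_neg (by omega), if_neg (by omega), zero_mul]

/-- If the normalized sizes of the segments converge, then so does the worst-case rate. -/
theorem eventually_abs_worstRate_sub_le {M r : ℝ} (hN : 1 ≤ N) (hM0 : 0 ≤ M) (hMN : M ≤ N)
    (hr : 1 ≤ r) (hF : Tendsto F L atTop)
    (hcache : ∀ k i, Tendsto (fun x => ((Z x k i).card : ℝ) / F x) L (𝓝 (M / N)))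
    (hseg : ∀ i B, Tendsto (fun x => ((segment (Z x) i B).card : ℝ) / F x) L
      (𝓝 (r * q N M r ^ B.card * (1 - q N M r) ^ (K - B.card))))
    {s : ℕ} (hs : IsThreshold N K M r s) {ε : ℝ} (hε : 0 < ε) :
    ∀ᶠ x in L, ∀ U : (Fin K → Fin N) → Finset (Fin K), (∀ d, IsLeaderSet d (U d)) →
      |worstRate (Z x) (F x) U - Rdec N K M r s| ≤ ε := by
  have hlim : ∀ d : Fin K → Fin N, Tendsto (fun x => (∑ j ∈ Icc 1 K, (incr (Z x) d (F x) j : ℝ) *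
      ((K.choose j : ℝ) - ((K - (univ.image d).card).choose j : ℝ))) / F x) L
      (𝓝 (∑ j ∈ Icc 1 K, limitLength N K M r s j *
        ((K.choose j : ℝ) - ((K - (univ.image d).card).choose j : ℝ)))) := by
    intro d
    simp only [sum_div, mul_div_right_comm]
    refine tendsto_finsetSum _ fun j hj => Tendsto.mul_const _ ?_
    rw [mem_Icc] at hj
    rw [← min_eq_limitLength hN hM0 hMN hr hs hj.1 hj.2]
    exact tendsto_incr_div hN hM0 hMN hr hF hcache hseg d hj.1 hj.2
  -- The limiting lengths are nonnegative and do not depend on `d`, and more leaders meet more sets,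
  -- so the limiting load grows with the number of different requests.
  have hle : ∀ d : Fin K → Fin N, ∑ j ∈ Icc 1 K, limitLength N K M r s j *
      ((K.choose j : ℝ) - ((K - (univ.image d).card).choose j : ℝ)) ≤ Rdec N K M r s := by
    intro d
    rw [← sum_limitLength hs]
    have hcard : (univ.image d).card ≤ min N K := by
      refine le_min ?_ ?_
      · simpa using card_le_univ (univ.image d)
      · simpa using card_image_le (s := univ) (f := d)
    refine sum_le_sum fun j _ =>
      mul_le_mul_of_nonneg_left ?_ (limitLength_nonneg hN hM0 hMN hr hs j)
    have : (K - min N K).choose j ≤ (K - (univ.image d).card).choose j :=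
      Nat.choose_le_choose j (by omega)
    have : ((K - min N K).choose j : ℝ) ≤ (K - (univ.image d).card).choose j := by
      exact_mod_cast this
    linarith
  obtain ⟨d₀, hd₀⟩ := exists_card_image_eq (K := K) hN
  have hlim₀ := hlim d₀
  rw [hd₀, sum_limitLength hs] at hlim₀
  have hFpos : ∀ᶠ x in L, 0 < F x := hF.eventually_gt_atTop 0
  -- The upper bound on the maximum needs all of the finitely many `d`; the lower bound needs only
  -- the extremal `d₀`.
  filter_upwards [hFpos, eventually_all.2 fun d =>
      (hlim d).eventually_le_const (lt_of_le_of_lt (hle d) (lt_add_of_pos_right _ hε)),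
    hlim₀.eventually_const_le (sub_lt_self _ hε)] with x hx hup hlow U hU
  have hload : ∀ d, (load (Z x) d (F x) (U d) : ℝ) = ∑ j ∈ Icc 1 K, (incr (Z x) d (F x) j : ℝ) *
      ((K.choose j : ℝ) - ((K - (univ.image d).card).choose j : ℝ)) := by
    intro d
    rw [load_eq_sum, (hU d).card]
  have hxR : (0 : ℝ) < F x := by exact_mod_cast hx
  rw [abs_sub_le_iff, worstRate, sub_le_iff_le_add', sub_le_comm]
  constructor
  · obtain ⟨d, -, hd⟩ := exists_mem_eq_sup univ ⟨d₀, mem_univ _⟩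
      (fun d => load (Z x) d (F x) (U d))
    rw [hd, hload]
    exact hup d
  · refine hlow.trans ?_
    rw [← hd₀, ← hload]
    gcongr
    exact le_sup (f := fun d => load (Z x) d (F x) (U d)) (mem_univ d₀)

end Load

/-! ### Counting placements: one and two positions, independence of users -/

section Counting

variable {n c : ℕ}

theorem card_filter_disjoint (n c : ℕ) (P : Finset (Fin n)) :
    (univ.filter fun T : {T : Finset (Fin n) // T.card = c} => Disjoint T.1 P).card =
      (n - P.card).choose c := by
  have h := card_powersetCard c Pᶜ
  rw [card_compl, Fintype.card_fin] at h
  rw [← h]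
  refine card_bij (fun T _ => T.1) ?_ ?_ ?_
  · intro T hT
    rw [mem_filter] at hT
    exact mem_powersetCard.2 ⟨subset_compl_iff_disjoint_right.2 hT.2, T.2⟩
  · intro T _ T' _ h
    exact Subtype.ext h
  · intro T hT
    rw [mem_powersetCard, subset_compl_iff_disjoint_right] at hT
    exact ⟨⟨T, hT.2⟩, by simpa using hT.1, rfl⟩

theorem card_subsets (n c : ℕ) :
    Fintype.card {T : Finset (Fin n) // T.card = c} = n.choose c := by
  simp

theorem card_filter_notMem (hc : c ≤ n) (t : Fin n) :
    ((univ.filter fun T : {T : Finset (Fin n) // T.card = c} => t ∉ T.1).card : ℝ) =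
      n.choose c * (1 - (c : ℝ) / n) := by
  have h := card_filter_disjoint n c {t}
  simp only [disjoint_singleton_right, card_singleton] at h
  rw [h]
  obtain ⟨m, rfl⟩ : ∃ m, n = m + 1 := ⟨n - 1, by have := t.2; omega⟩
  have h2 := Nat.choose_mul_succ_eq m c
  have h3 : (m.choose c : ℝ) * (m + 1 : ℕ) = (m + 1).choose c * ((m + 1 : ℕ) - c) := by
    rw [← Nat.cast_sub hc]
    exact_mod_cast h2
  have : ((m + 1 : ℕ) : ℝ) ≠ 0 := by positivity
  rw [Nat.add_sub_cancel, one_sub_div this, mul_div_assoc', eq_div_iff this]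
  exact h3

/-- A uniform `c`-subset avoids both positions with probability `(1 - c / n) * (1 - c / (n - 1))`
when `c ≤ n - 2`, and `0` otherwise. -/
theorem card_filter_notMem_notMem_le (hc : c ≤ n) {t t' : Fin n} (ht : t ≠ t') :
    ((univ.filter fun T : {T : Finset (Fin n) // T.card = c} => t ∉ T.1 ∧ t' ∉ T.1).card : ℝ) ≤
      n.choose c * (1 - (c : ℝ) / n) ^ 2 := by
  have h := card_filter_disjoint n c {t, t'}
  simp only [disjoint_insert_right, disjoint_singleton_right, card_pair ht] at h
  have h1 := card_filter_notMem hc t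
  have h1' := card_filter_disjoint n c {t}
  simp only [disjoint_singleton_right, card_singleton] at h1'
  rw [h1'] at h1
  rw [h]
  obtain ⟨m, rfl⟩ : ∃ m, n = m + 2 := ⟨n - 2, by
    have := t.2; have := t'.2; have : t.1 ≠ t'.1 := fun h => ht (Fin.ext h); omega⟩
  simp only [Nat.add_sub_cancel, show m + 2 - 1 = m + 1 by omega] at h1 ⊢
  rcases Nat.lt_or_ge m c with hmc | hmc
  · rw [Nat.choose_eq_zero_of_lt hmc]
    push_cast
    positivity
  have h2 : (m.choose c : ℝ) * (m + 1 : ℕ) = (m + 1).choose c * ((m + 1 : ℕ) - c) := by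
    rw [← Nat.cast_sub (by omega)]
    exact_mod_cast Nat.choose_mul_succ_eq m c
  have hm1 : (0 : ℝ) < (m + 1 : ℕ) := by positivity
  have hm2 : (0 : ℝ) < (m + 2 : ℕ) := by positivity
  rw [← eq_div_iff hm1.ne', mul_div_assoc, sub_div, div_self hm1.ne'] at h2
  rw [h2, pow_two, ← mul_assoc, ← h1]
  gcongr
  omega

theorem card_filter_mem_iff (hc : c ≤ n) (t : Fin n) (b : Prop) [Decidable b] :
    ((univ.filter fun T : {T : Finset (Fin n) // T.card = c} => t ∈ T.1 ↔ b).card : ℝ) =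
      n.choose c * (if b then (c : ℝ) / n else 1 - (c : ℝ) / n) := by
  have h := card_filter_notMem hc t
  by_cases hb : b
  · simp only [hb, iff_true, if_true]
    have h1 := card_filter_add_card_filter_not
      (s := (univ : Finset {T : Finset (Fin n) // T.card = c})) (fun T => t ∈ T.1)
    rw [card_univ, card_subsets, ← Nat.cast_inj (R := ℝ), Nat.cast_add, h] at h1
    linarith
  · simpa only [hb, iff_false, if_false] using h

/-- The membership of two different positions in a random set of given size is negatively
correlated. -/
theorem card_filter_mem_iff_and_le (hc : c ≤ n) {t t' : Fin n} (ht : t ≠ t') (b : Prop)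
    [Decidable b] :
    ((univ.filter fun T : {T : Finset (Fin n) // T.card = c} =>
      (t ∈ T.1 ↔ b) ∧ (t' ∈ T.1 ↔ b)).card : ℝ) ≤
      n.choose c * (if b then (c : ℝ) / n else 1 - (c : ℝ) / n) ^ 2 := by
  have h := card_filter_notMem_notMem_le hc ht
  by_cases hb : b
  · simp only [hb, iff_true, if_true]
    -- Inclusion-exclusion transfers the bound to the complementary events: with `p = c / n`, `1 - 2
    -- * (1 - p) + (1 - p) ^ 2 = p ^ 2`.
    have hincl : (univ.filter fun T : {T : Finset (Fin n) // T.card = c} =>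
        t ∈ T.1 ∧ t' ∈ T.1).card + (univ.filter fun T : {T : Finset (Fin n) // T.card = c} =>
        t ∉ T.1).card + (univ.filter fun T : {T : Finset (Fin n) // T.card = c} =>
        t' ∉ T.1).card = n.choose c + (univ.filter fun T : {T : Finset (Fin n) // T.card = c} =>
        t ∉ T.1 ∧ t' ∉ T.1).card := by
      rw [← card_subsets, ← card_univ]
      simp only [card_eq_sum_ones, sum_filter, ← sum_add_distrib]
      refine sum_congr rfl fun T _ => ?_
      by_cases h1 : t ∈ T.1 <;> by_cases h2 : t' ∈ T.1 <;> simp [h1, h2]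
    rw [← Nat.cast_inj (R := ℝ)] at hincl
    push_cast at hincl
    rw [card_filter_notMem hc, card_filter_notMem hc] at hincl
    linarith
  · simpa only [hb, iff_false, if_false] using h

variable {K K' N : ℕ}

/-- Conditions on different coordinates of a finite product are independent. -/
theorem card_filter_pi {α : Type*} [Fintype α] [Nonempty α] (e : Fin K ↪ Fin K') (i : Fin N)
    (P : Fin K → α → Prop) [∀ k, DecidablePred (P k)]
    [hP : DecidablePred fun ω : Fin K' → Fin N → α => ∀ k, P k (ω (e k) i)] :
    ((univ.filter fun ω : Fin K' → Fin N → α => ∀ k, P k (ω (e k) i)).card : ℝ) =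
      Fintype.card (Fin K' → Fin N → α) *
        ∏ k, ((univ.filter (P k)).card : ℝ) / Fintype.card α := by
  classical
  have hD : (Fintype.card α : ℝ) ≠ 0 := by exact_mod_cast Fintype.card_ne_zero
  -- The condition on coordinate `(k', i')`; it is void unless `i' = i` and `k'` is a requesting
  -- user.
  let Q : Fin K' → Fin N → Finset α := fun k' i' =>
    univ.filter fun T => i' = i → ∀ k, e k = k' → P k T
  have hfilter : (univ.filter fun ω : Fin K' → Fin N → α => ∀ k, P k (ω (e k) i)) =
      Fintype.piFinset fun k' => Fintype.piFinset (Q k') := by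
    ext ω
    simp only [mem_filter, Fintype.mem_piFinset, Q]
    constructor
    · rintro ⟨-, h⟩ k' i'
      refine ⟨mem_univ _, ?_⟩
      rintro rfl k rfl
      exact h k
    · intro h
      exact ⟨mem_univ _, fun k => (h (e k) i).2 rfl k rfl⟩
  have hprod : ∏ k' : Fin K', ∏ i' : Fin N, ((Q k' i').card : ℝ) / Fintype.card α =
      ∏ k, ((univ.filter (P k)).card : ℝ) / Fintype.card α := by
    have h1 : ∀ k', ∏ i' : Fin N, ((Q k' i').card : ℝ) / Fintype.card α =
        ((Q k' i).card : ℝ) / Fintype.card α := by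
      intro k'
      refine prod_eq_single i (fun i' _ hi' => ?_) (by simp)
      have : Q k' i' = univ := by simp [Q, hi']
      rw [this, card_univ, div_self hD]
    simp only [h1]
    rw [← prod_subset (subset_univ (univ.map e)), prod_map]
    · refine prod_congr rfl fun k _ => ?_
      congr 3
      ext T
      simp [Q]
    · intro k' _ hk'
      have : Q k' i = univ := by
        simp only [Q, filter_eq_self]
        intro T _ _ k hk
        exact absurd (mem_map.2 ⟨k, mem_univ _, hk⟩) hk'
      rw [this, card_univ, div_self hD]
  rw [hfilter, Fintype.card_piFinset, ← hprod]
  simp only [Fintype.card_piFinset, prod_div_distrib, prod_const, card_univ, Fintype.card_fin,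
    Fintype.card_fun]
  push_cast
  exact (mul_div_cancel₀ _ (pow_ne_zero _ (pow_ne_zero _ hD))).symm

/-- The choices of the requesting users are independent. -/
theorem card_filter_placement (hc : c ≤ n) (e : Fin K ↪ Fin K') (i : Fin N)
    (P : Fin K → {T : Finset (Fin n) // T.card = c} → Prop) [∀ k, DecidablePred (P k)]
    [hP : DecidablePred fun ω : Placement K' N n c => ∀ k, P k (ω (e k) i)] :
    ((univ.filter fun ω : Placement K' N n c => ∀ k, P k (ω (e k) i)).card : ℝ) =
      Fintype.card (Placement K' N n c) *
        ∏ k, ((univ.filter (P k)).card : ℝ) / n.choose c := by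
  have : Nonempty {T : Finset (Fin n) // T.card = c} := by
    rw [← Fintype.card_pos_iff, card_subsets]
    exact Nat.choose_pos hc
  rw [← card_subsets]
  exact card_filter_pi (α := {T : Finset (Fin n) // T.card = c}) (hP := hP) e i P

theorem mem_segment_caches (ω : Placement K' N n c) (e : Fin K ↪ Fin K') (i : Fin N)
    (B : Finset (Fin K)) (t : Fin n) :
    t ∈ segment (ω.caches e) i B ↔ ∀ k, t ∈ (ω (e k) i).1 ↔ k ∈ B := by
  rw [segment, mem_filter]
  exact and_iff_right (mem_univ t)

end Counting

/-! ### First and second moments of the segment sizes -/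

section Moments

variable {K K' N n c : ℕ}

theorem prod_ite_mem (B : Finset (Fin K)) (p : ℝ) :
    ∏ k, (if k ∈ B then p else 1 - p) = p ^ B.card * (1 - p) ^ (K - B.card) := by
  rw [prod_ite, prod_const, prod_const]
  congr 2
  · simp
  · rw [filter_not, card_sdiff_of_subset (filter_subset _ _)]
    simp

theorem card_filter_mem_segment (hc : c ≤ n) (e : Fin K ↪ Fin K') (i : Fin N)
    (B : Finset (Fin K)) (t : Fin n) :
    ((univ.filter fun ω : Placement K' N n c => t ∈ segment (ω.caches e) i B).card : ℝ) =
      Fintype.card (Placement K' N n c) *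
        (((c : ℝ) / n) ^ B.card * (1 - (c : ℝ) / n) ^ (K - B.card)) := by
  have hD : (n.choose c : ℝ) ≠ 0 := by exact_mod_cast (Nat.choose_pos hc).ne'
  have h := card_filter_placement (N := N) hc e i (fun k T => t ∈ T.1 ↔ k ∈ B)
  simp only [mem_segment_caches]
  rw [h, ← prod_ite_mem]
  congr 1
  refine prod_congr rfl fun k _ => ?_
  rw [card_filter_mem_iff hc, mul_div_cancel_left₀ _ hD]

theorem card_filter_mem_segment_and_le (hc : c ≤ n) (e : Fin K ↪ Fin K') (i : Fin N)
    (B : Finset (Fin K)) {t t' : Fin n} (ht : t ≠ t') :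
    ((univ.filter fun ω : Placement K' N n c =>
      t ∈ segment (ω.caches e) i B ∧ t' ∈ segment (ω.caches e) i B).card : ℝ) ≤
      Fintype.card (Placement K' N n c) *
        (((c : ℝ) / n) ^ B.card * (1 - (c : ℝ) / n) ^ (K - B.card)) ^ 2 := by
  have hD : (0 : ℝ) < n.choose c := by exact_mod_cast Nat.choose_pos hc
  have h := card_filter_placement (N := N) hc e i (fun k T => (t ∈ T.1 ↔ k ∈ B) ∧ (t' ∈ T.1 ↔ k ∈ B))
  simp only [mem_segment_caches, ← forall_and]
  rw [h, ← prod_ite_mem, ← prod_pow]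
  gcongr with k _
  rw [div_le_iff₀' hD]
  exact card_filter_mem_iff_and_le hc ht _

/-- The variance of the size of a segment is at most the length of the coded files. -/
theorem sum_sq_card_segment_sub_le (hc : c ≤ n) (e : Fin K ↪ Fin K') (i : Fin N)
    (B : Finset (Fin K)) :
    ∑ ω : Placement K' N n c, (((segment (ω.caches e) i B).card : ℝ) -
      n * (((c : ℝ) / n) ^ B.card * (1 - (c : ℝ) / n) ^ (K - B.card))) ^ 2 ≤
      (n : ℝ) * Fintype.card (Placement K' N n c) := by
  set μ := ((c : ℝ) / n) ^ B.card * (1 - (c : ℝ) / n) ^ (K - B.card) with hμ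
  set Ω : ℝ := (Fintype.card (Placement K' N n c) : ℝ) with hΩ
  have hcard : ∀ ω : Placement K' N n c, ((segment (ω.caches e) i B).card : ℝ) =
      ∑ t, if t ∈ segment (ω.caches e) i B then (1 : ℝ) else 0 := by
    intro ω
    simp
  have h1 : ∑ ω : Placement K' N n c, ((segment (ω.caches e) i B).card : ℝ) = n * (Ω * μ) := by
    simp only [hcard]
    rw [sum_comm]
    simp only [sum_boole, card_filter_mem_segment hc e i B]
    simp [hΩ, hμ]
  have h2 : ∑ ω : Placement K' N n c, ((segment (ω.caches e) i B).card : ℝ) ^ 2 ≤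
      n * Ω + n * n * (Ω * μ ^ 2) := by
    have hexp : ∀ ω : Placement K' N n c, ((segment (ω.caches e) i B).card : ℝ) ^ 2 =
        ∑ t, ∑ t', if t ∈ segment (ω.caches e) i B ∧ t' ∈ segment (ω.caches e) i B
          then (1 : ℝ) else 0 := by
      intro ω
      rw [hcard, sq, sum_mul_sum]
      refine sum_congr rfl fun t _ => sum_congr rfl fun t' _ => ?_
      by_cases h1 : t ∈ segment (ω.caches e) i B <;>
        by_cases h2 : t' ∈ segment (ω.caches e) i B <;> simp [h1, h2]
    simp only [hexp]
    rw [sum_comm]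
    -- Pairs `t ≠ t'` contribute at most `Ω * μ ^ 2` by negative correlation, and the diagonal at
    -- most `Ω` each. Summed up, the terms in `μ ^ 2` cancel in the variance and `n * Ω` remains.
    have hterm : ∀ t t' : Fin n, ∑ ω : Placement K' N n c,
        (if t ∈ segment (ω.caches e) i B ∧ t' ∈ segment (ω.caches e) i B then (1 : ℝ) else 0) ≤
        (if t = t' then Ω else 0) + Ω * μ ^ 2 := by
      intro t t'
      rw [sum_boole]
      split_ifs with htt
      · have : ((univ.filter fun ω : Placement K' N n c =>
            t ∈ segment (ω.caches e) i B ∧ t' ∈ segment (ω.caches e) i B).card : ℝ) ≤ Ω := by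
          rw [hΩ]
          exact_mod_cast card_le_univ _
        have : 0 ≤ Ω * μ ^ 2 := by positivity
        linarith
      · rw [zero_add]
        exact card_filter_mem_segment_and_le hc e i B htt
    calc _ ≤ ∑ t : Fin n, ∑ t' : Fin n, ((if t = t' then Ω else 0) + Ω * μ ^ 2) := by
          refine sum_le_sum fun t _ => ?_
          rw [sum_comm]
          exact sum_le_sum fun t' _ => hterm t t'
      _ = _ := by
          simp only [sum_add_distrib, sum_ite_eq, mem_univ, if_true, sum_const, card_univ,
            Fintype.card_fin, nsmul_eq_mul]
          ring
  have h3 : ∀ ω : Placement K' N n c, (((segment (ω.caches e) i B).card : ℝ) - n * μ) ^ 2 =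
      ((segment (ω.caches e) i B).card : ℝ) ^ 2 -
        2 * (n * μ) * ((segment (ω.caches e) i B).card : ℝ) + (n * μ) ^ 2 := fun ω => by ring
  simp only [h3, sum_add_distrib, sum_sub_distrib, ← mul_sum, h1, sum_const, card_univ,
    nsmul_eq_mul]
  rw [← hΩ]
  nlinarith

end Moments

/-! ### The placement law as normalized counting -/

section Law

open MeasureTheory ProbabilityTheory

variable {K K' N n c : ℕ}

instance (K' N n c : ℕ) : MeasurableSingletonClass (Placement K' N n c) := ⟨fun _ => trivial⟩

theorem nonempty_placement (K' N : ℕ) (hc : c ≤ n) : Nonempty (Placement K' N n c) := by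
  obtain ⟨T, -, hT⟩ := exists_subset_card_eq (s := (univ : Finset (Fin n))) (by simpa using hc)
  exact ⟨fun _ _ => ⟨T, hT⟩⟩

theorem isProbabilityMeasure_placementLaw (K' N : ℕ) (hc : c ≤ n) :
    IsProbabilityMeasure (placementLaw K' N n c) := by
  have := nonempty_placement K' N hc
  exact isProbabilityMeasure_uniformOn Set.finite_univ Set.univ_nonempty

theorem placementLaw_real_apply (P : Placement K' N n c → Prop) [DecidablePred P] :
    (placementLaw K' N n c).real {ω | P ω} =
      ((univ.filter P).card : ℝ) / Fintype.card (Placement K' N n c) := by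
  have h : {ω | P ω} = ((univ.filter P : Finset (Placement K' N n c)) : Set _) := by
    ext; simp
  rw [placementLaw, measureReal_def, uniformOn_univ, h, Measure.count_apply_finset,
    ENNReal.toReal_div, ENNReal.toReal_natCast, ENNReal.toReal_natCast]

/-- Chebyshev's inequality for the size of a segment. -/
theorem placementLaw_real_card_segment_le (hc : c ≤ n) (e : Fin K ↪ Fin K') (i : Fin N)
    (B : Finset (Fin K)) {η : ℝ} (hη : 0 < η) :
    (placementLaw K' N n c).real {ω | η ≤ |((segment (ω.caches e) i B).card : ℝ) -
      n * (((c : ℝ) / n) ^ B.card * (1 - (c : ℝ) / n) ^ (K - B.card))|} ≤ n / η ^ 2 := by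
  classical
  have := nonempty_placement K' N hc
  have hΩ : (0 : ℝ) < Fintype.card (Placement K' N n c) := by exact_mod_cast Fintype.card_pos
  rw [placementLaw_real_apply, div_le_div_iff₀ hΩ (by positivity)]
  refine le_trans ?_ (sum_sq_card_segment_sub_le hc e i B)
  rw [← nsmul_eq_mul, ← sum_const]
  refine (sum_le_sum fun ω hω => ?_).trans
    (sum_le_sum_of_subset_of_nonneg (subset_univ _) fun ω _ _ => sq_nonneg _)
  rw [mem_filter] at hω
  rw [← sq_abs (_ - _)]
  gcongr
  exact hω.2

end Law

/-! ### Convergence in probability -/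

section Convergence

open MeasureTheory Filter Topology

variable {K K' N : ℕ} {M r : ℝ}

theorem tendsto_codeLength_div (hr : 1 ≤ r) :
    Tendsto (fun F : ℕ => (codeLength r F : ℝ) / F) atTop (𝓝 r) :=
  (tendsto_nat_floor_mul_div_atTop (by linarith : 0 ≤ r)).comp tendsto_natCast_atTop_atTop

theorem tendsto_cacheShare_div (N : ℕ) (hM0 : 0 ≤ M) :
    Tendsto (fun F : ℕ => (cacheShare M N F : ℝ) / F) atTop (𝓝 (M / N)) := by
  have h := (tendsto_nat_floor_mul_div_atTop (by positivity : 0 ≤ M / N)).comp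
    tendsto_natCast_atTop_atTop
  refine h.congr fun F => ?_
  simp only [Function.comp, cacheShare, mul_div_right_comm]

theorem tendsto_cacheShare_div_codeLength (hM0 : 0 ≤ M) (hr : 1 ≤ r) :
    Tendsto (fun F : ℕ => (cacheShare M N F : ℝ) / codeLength r F) atTop (𝓝 (q N M r)) := by
  have h := (tendsto_cacheShare_div N hM0).div (tendsto_codeLength_div hr) (by positivity)
  rw [div_div, mul_comm (N : ℝ) r] at h
  refine h.congr' ?_
  filter_upwards [eventually_gt_atTop 0] with F hF
  have : (F : ℝ) ≠ 0 := by positivity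
  exact div_div_div_cancel_right₀ this _ _

/-- The normalized sizes of the segments converge in probability. -/
theorem tendsto_placementLaw_card_segment (hM0 : 0 ≤ M) (hMN : M ≤ N) (hr : 1 ≤ r)
    (e : Fin K ↪ Fin K') (i : Fin N) (B : Finset (Fin K)) {δ : ℝ} (hδ : 0 < δ) :
    Tendsto (fun F : ℕ => (placementLaw K' N (codeLength r F) (cacheShare M N F)).real
      {ω | δ ≤ |((segment (ω.caches e) i B).card : ℝ) / F -
        r * q N M r ^ B.card * (1 - q N M r) ^ (K - B.card)|}) atTop (𝓝 0) := by
  have hp := tendsto_cacheShare_div_codeLength (N := N) hM0 hr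
  have hmean : Tendsto (fun F : ℕ => (codeLength r F : ℝ) / F *
      (((cacheShare M N F : ℝ) / codeLength r F) ^ B.card *
        (1 - (cacheShare M N F : ℝ) / codeLength r F) ^ (K - B.card))) atTop
      (𝓝 (r * (q N M r ^ B.card * (1 - q N M r) ^ (K - B.card)))) :=
    (tendsto_codeLength_div hr).mul ((hp.pow _).mul ((hp.const_sub 1).pow _))
  rw [← mul_assoc] at hmean
  -- Chebyshev's bound `n / η ^ 2` at `η = (δ / 2) * F`; the other `δ / 2` covers the distance of
  -- the normalized mean from its limit.
  have hbound : Tendsto (fun F : ℕ => (codeLength r F : ℝ) / F * ((4 / δ ^ 2) / F)) atTop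
      (𝓝 (r * 0)) :=
    (tendsto_codeLength_div hr).mul (tendsto_natCast_atTop_atTop.const_div_atTop _)
  rw [mul_zero] at hbound
  refine tendsto_of_tendsto_of_tendsto_of_le_of_le' tendsto_const_nhds hbound
    (Eventually.of_forall fun F => measureReal_nonneg) ?_
  filter_upwards [eventually_gt_atTop 0, Metric.tendsto_nhds.1 hmean (δ / 2) (half_pos hδ)]
    with F hF hclose
  have hFR : (0 : ℝ) < F := by exact_mod_cast hF
  have hc := cacheShare_le_codeLength hMN hr F
  have := isProbabilityMeasure_placementLaw K' N hc
  refine (measureReal_mono ?_).trans ((placementLaw_real_card_segment_le hc e i B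
    (mul_pos (half_pos hδ) hFR)).trans_eq ?_)
  · intro ω hω
    simp only [Set.mem_ofPred_eq] at hω ⊢
    rw [Real.dist_eq] at hclose
    set X := ((segment (ω.caches e) i B).card : ℝ)
    set m := (((cacheShare M N F : ℝ) / codeLength r F) ^ B.card *
        (1 - (cacheShare M N F : ℝ) / codeLength r F) ^ (K - B.card))
    set g := r * q N M r ^ B.card * (1 - q N M r) ^ (K - B.card)
    have h1 := abs_sub_le (X / F) (codeLength r F / F * m) g
    have h2 : δ / 2 ≤ |X / F - codeLength r F / F * m| := by linarith
    have h3 : X / F - codeLength r F / F * m = (X - codeLength r F * m) / F := by ring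
    rwa [h3, abs_div, abs_of_pos hFR, le_div_iff₀ hFR] at h2
  · field_simp
    ring

/-- The deterministic limit is applied along a filter on all triples (file size, placement,
requesting users), generated by `F → ∞` and convergence of the segment sizes. It yields `F₀` and `δ`
such that, for `F ≥ F₀`, segment sizes within `δ` of their limits force the rate to be within `ε`,
whatever the leaders. -/
theorem tendsto_placementLaw_worstRate (hN : 1 ≤ N) (hM0 : 0 ≤ M) (hMN : M ≤ N) (hr : 1 ≤ r)
    {s : ℕ} (hs : IsThreshold N K M r s) {ε : ℝ} (hε : 0 < ε) :
    Tendsto (fun F : ℕ => (placementLaw K' N (codeLength r F) (cacheShare M N F)).real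
      {ω | ∀ (e : Fin K ↪ Fin K') (U : (Fin K → Fin N) → Finset (Fin K)),
        (∀ d, IsLeaderSet d (U d)) →
          |worstRate (ω.caches e) F U - Rdec N K M r s| ≤ ε}) atTop (𝓝 1) := by
  let g : Fin N × Finset (Fin K) → ℝ := fun y =>
    r * q N M r ^ y.2.card * (1 - q N M r) ^ (K - y.2.card)
  let ι := Σ F : ℕ, Placement K' N (codeLength r F) (cacheShare M N F) × (Fin K ↪ Fin K')
  let Z : ∀ x : ι, Caches K N (codeLength r x.1) := fun x => x.2.1.caches x.2.2
  let σ : ι → Fin N × Finset (Fin K) → ℝ := fun x y => ((segment (Z x) y.1 y.2).card : ℝ) / x.1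
  let L : Filter ι := comap (fun x => (x.1, σ x)) (atTop ×ˢ 𝓝 g)
  have hLF : Tendsto (fun x : ι => x.1) L atTop := tendsto_fst.comp tendsto_comap
  have hLσ : Tendsto σ L (𝓝 g) := tendsto_snd.comp tendsto_comap
  have hev := eventually_abs_worstRate_sub_le (Z := Z) hN hM0 hMN hr hLF
    (fun k i => ((tendsto_cacheShare_div N hM0).comp hLF).congr fun x => by
      have : (Z x k i).card = cacheShare M N x.1 := (x.2.1 (x.2.2 k) i).2
      simp only [Function.comp, this])
    (fun i B => (tendsto_pi_nhds.1 hLσ (i, B))) hs hε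
  obtain ⟨t, ht, hsub⟩ := mem_comap.1 hev
  obtain ⟨s₁, hs₁, s₂, hs₂, hprod⟩ := mem_prod_iff.1 ht
  obtain ⟨F₀, hF₀⟩ := mem_atTop_sets.1 hs₁
  obtain ⟨δ, hδ, hball⟩ := Metric.mem_nhds_iff.1 hs₂
  -- Union bound over the finitely many choices of requesting users, file and segment; this number
  -- does not depend on `F`.
  have hbad : Tendsto (fun F : ℕ => 1 - ∑ e : Fin K ↪ Fin K', ∑ y : Fin N × Finset (Fin K),
      (placementLaw K' N (codeLength r F) (cacheShare M N F)).real
        {ω | δ ≤ |((segment (ω.caches e) y.1 y.2).card : ℝ) / F -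
          r * q N M r ^ y.2.card * (1 - q N M r) ^ (K - y.2.card)|}) atTop (𝓝 1) := by
    have := tendsto_finsetSum (univ : Finset (Fin K ↪ Fin K')) fun e _ =>
      tendsto_finsetSum (univ : Finset (Fin N × Finset (Fin K))) fun y _ =>
        tendsto_placementLaw_card_segment (K' := K') hM0 hMN hr e y.1 y.2 hδ
    simpa using this.const_sub 1
  refine tendsto_of_tendsto_of_tendsto_of_le_of_le' hbad tendsto_const_nhds ?_ ?_
  · filter_upwards [eventually_ge_atTop F₀] with F hF
    have := isProbabilityMeasure_placementLaw K' N (cacheShare_le_codeLength hMN hr F)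
    set G := {ω : Placement K' N (codeLength r F) (cacheShare M N F) |
      ∀ (e : Fin K ↪ Fin K') (U : (Fin K → Fin N) → Finset (Fin K)),
        (∀ d, IsLeaderSet d (U d)) →
          |worstRate (ω.caches e) F U - Rdec N K M r s| ≤ ε}
    have hG : MeasurableSet G := trivial
    have hcompl := probReal_add_probReal_compl
      (μ := placementLaw K' N (codeLength r F) (cacheShare M N F)) hG
    have hsubset : Gᶜ ⊆ ⋃ e : Fin K ↪ Fin K', ⋃ y : Fin N × Finset (Fin K),
        {ω | δ ≤ |((segment (ω.caches e) y.1 y.2).card : ℝ) / F -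
          r * q N M r ^ y.2.card * (1 - q N M r) ^ (K - y.2.card)|} := by
      intro ω hω
      by_contra hnot
      simp only [Set.mem_iUnion, Set.mem_ofPred_eq, not_exists, not_le] at hnot
      refine hω fun e => ?_
      refine hsub (a := (⟨F, ω, e⟩ : ι)) (hprod ⟨hF₀ F hF, hball ?_⟩)
      rw [Metric.mem_ball, dist_pi_lt_iff hδ]
      intro y
      rw [Real.dist_eq]
      exact hnot e y
    have h1 := (measureReal_mono (μ := placementLaw K' N (codeLength r F) (cacheShare M N F))
      hsubset).trans ((measureReal_iUnion_fintype_le _).trans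
        (sum_le_sum fun e _ => measureReal_iUnion_fintype_le _))
    linarith
  · refine Eventually.of_forall fun F => ?_
    have := isProbabilityMeasure_placementLaw K' N (cacheShare_le_codeLength hMN hr F)
    exact measureReal_le_one

end Convergence

end CodedCaching

theorem mainTheorem1 (N K K' : ℕ) (hN : 1 ≤ N) (hK : 1 ≤ K) (hKK' : K ≤ K')
    (M r : ℝ) (hM0 : 0 ≤ M) (hMN : M ≤ N) (hr : 1 ≤ r) :
    -- the threshold is well defined
    (M < N → ∃! s, CodedCaching.IsThreshold N K M r s) ∧
    -- the MDS codes exist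
    (∀ F : ℕ, ∃ (𝔽 : Type) (_ : Field 𝔽) (_ : Finite 𝔽) (_ : CharP 𝔽 2)
      (enc : (Fin F → 𝔽) →ₗ[𝔽] (Fin (CodedCaching.codeLength r F) → 𝔽)),
      CodedCaching.IsMDS enc) ∧
    -- every user respects the memory constraint
    (∀ (F : ℕ) (ω : CodedCaching.Placement K' N (CodedCaching.codeLength r F)
        (CodedCaching.cacheShare M N F)) (k : Fin K'),
      ((∑ i, (ω k i).1.card : ℕ) : ℝ) ≤ M * F) ∧
    -- every requesting user decodes its file, for all requests and all choices of the leaders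
    (∀ (F : ℕ) (𝔽 : Type) [Field 𝔽] [Finite 𝔽] [CharP 𝔽 2]
        (enc : (Fin F → 𝔽) → (Fin (CodedCaching.codeLength r F) → 𝔽)),
      CodedCaching.IsMDS enc →
      ∀ (ω : CodedCaching.Placement K' N (CodedCaching.codeLength r F)
          (CodedCaching.cacheShare M N F)) (e : Fin K ↪ Fin K') (d : Fin K → Fin N)
        (U : Finset (Fin K)), CodedCaching.IsLeaderSet d U →
      ∀ k : Fin K, CodedCaching.CanDecode enc (ω.caches e) d U k) ∧
    -- the worst-case normalized rate tends to `Rdec` in probability as `F → ∞`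
    (∀ s : ℕ, CodedCaching.IsThreshold N K M r s → ∀ ε : ℝ, 0 < ε →
      Filter.Tendsto
        (fun F : ℕ =>
          (CodedCaching.placementLaw K' N (CodedCaching.codeLength r F)
            (CodedCaching.cacheShare M N F)).real
            {ω | ∀ (e : Fin K ↪ Fin K') (U : (Fin K → Fin N) → Finset (Fin K)),
              (∀ d, CodedCaching.IsLeaderSet d (U d)) →
              |CodedCaching.worstRate (ω.caches e) F U - CodedCaching.Rdec N K M r s| ≤ ε})
        Filter.atTop (nhds 1)) := by
  exact ⟨fun h => CodedCaching.existsUnique_isThreshold hN hK hM0 h hr,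
    fun F => CodedCaching.exists_isMDS (CodedCaching.le_codeLength hr F),
    fun _ ω k => CodedCaching.sum_card_cache_le hM0 ω k,
    fun _ _ _ _ _ _ henc ω e d _ hU k => CodedCaching.canDecode henc (ω.caches e) d hU k,
    fun _ hs _ hε => CodedCaching.tendsto_placementLaw_worstRate hN hM0 hMN hr hs hε⟩
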